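/- **Proposition (a priori convexity and metric lower bound estimate).** *Setting.* Let $V$ be a compact complex affine manifold of dimension $n$ (the coordinate changes of its atlas are locally complex affine maps) with a constant coefficient Kähler metric $\omega_0=\sqrt{-1}\,b_{\alpha\bar\beta}\,dz^\alpha\wedge\overline{dz^\beta}$: in every chart of the atlas $(b_{\alpha\bar\beta})$ is a constant positive definite Hermitian matrix. Let $\mathcal R\subset\mathbb C$ be a bounded domain with smooth boundary, $\Omega_0$ the pullback of $\omega_0$ to $\mathcal R\times V$, and $\epsilon>0$. A *constant section* $S$ of $T^*_{2,0}(V)$ is a symmetric tensor $S_{\alpha\beta}\,dz^\alpha\otimes dz^\beta$ with constant components in every chart. *The problem.* For $F\in C^\infty(\partial\mathcal R\times V)$, a solution with boundary value $\sigma F$ ($\sigma\in[0,1]$) is a real function $\Phi$, continuous on $\overline{\mathcal R}\times V$ and at least $C^2$ on $\mathcal R\times V$, with $\Phi=\sigma F$ on $\partial\mathcal R\times V$, and in $\mathcal R\times V$ $$\Omega_0+\sqrt{-1}\,\partial\bar\partial\Phi>0,\qquad \Phi_{\tau\bar\tau}-\Phi_{\tau\bar\beta}\,g^{\alpha\bar\beta}\,\Phi_{\alpha\bar\tau}=\epsilon\,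 b_{\alpha\bar\beta}\,g^{\alpha\bar\beta},\qquad g_{\alpha\bar\beta}=b_{\alpha\bar\beta}+\Phi_{\alpha\bar\beta},\quad g^{\theta\bar\beta}g_{\alpha\bar\beta}=\delta_{\theta\alpha}.$$ (Up to a positive factor depending only on $n$ and absorbed in $\epsilon$, the equation is $(\Omega_0+\sqrt{-1}\partial\bar\partial\Phi)^{n+1}=\epsilon\sqrt{-1}\,d\tau\wedge d\bar\tau\wedge\Omega_0\wedge(\Omega_0+\sqrt{-1}\partial\bar\partial\Phi)^{n-1}$.) *Convexity.* For a positive definite Hermitian matrix $A$ and a symmetric matrix $B$ let $\Lambda(A,B)$ be the largest eigenvalue of $B\,\overline{A^{-1}}\,\overline{B}\,A^{-1}$; all eigenvalues of this matrix are real and non-negative. Let $\varphi\in C^2(V)$. On a chart domain, $\varphi$ is *strictly $(S,\omega_0)$-convex* if there $A=(b_{\alpha\bar\beta}+\varphi_{\alpha\bar\beta})>0$ and $\Lambda\big(A,(\varphi_{\alpha\beta}+S_{\alpha\beta})\big)<1$; it is strictly $(S,\omega_0)$-convex on $V$ if this holds on all chart domains of the atlas. Let $\delta>0$. - $\varphi$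 is *$(S,\omega_0)$-convex of degree $>\delta$* if on the domain of each chart of the atlas it is strictly $(S+\Theta,\omega_0)$-convex for every constant symmetric tensor $\Theta=\Theta_{\alpha\beta}dz^\alpha\otimes dz^\beta$ on that chart domain with $\Lambda\big((b_{\alpha\bar\beta}),(\Theta_{\alpha\beta})\big)\le\delta^2$. - $\varphi$ is *$(S,\omega_0)$-convex of global degree $>\delta$* if it is strictly $(S+\Theta,\omega_0)$-convex on $V$ for every constant section $\Theta$ of $T^*_{2,0}(V)$, defined on all of $V$, with $\Lambda\big((b_{\alpha\bar\beta}),(\Theta_{\alpha\beta})\big)\le\delta^2$ in every chart. *Continuity-path assumption.* For every $\sigma\in[0,1]$ the problem with boundary value $\sigma F$ has a solution $\Phi^\sigma\in C^4(\overline{\mathcal R}\times V)$, and $\sigma\mapsto\Phi^\sigma$, $\sigma\in[0,1]$, is continuous in the $C^2$ topology of $\overline{\mathcal R}\times V$. *Claim.* Let $\delta>0$, let $S$ be a constant section of $T^*_{2,0}(V)$, let $F\in C^\infty(\partial\mathcal R\times V)$ satisfy the continuity-path assumption, and let $\Phi$ be any solution with boundary value $F$. 1. If $F(\tau,\cdot)$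 is $(S,\omega_0)$-convex of degree $>\delta$ for every $\tau\in\partial\mathcal R$, then for every $\tau\in\overline{\mathcal R}$ the function $\Phi(\tau,\cdot)$ is $(S,\omega_0)$-convex of degree $>\delta$, and $\omega_0+\sqrt{-1}\,\partial\bar\partial\Phi(\tau,\cdot)>\delta\,\omega_0$. 2. If $F(\tau,\cdot)$ is $(S,\omega_0)$-convex of global degree $>\delta$ for every $\tau\in\partial\mathcal R$, then $\Phi(\tau,\cdot)$ is $(S,\omega_0)$-convex of global degree $>\delta$ for every $\tau\in\overline{\mathcal R}$. -/

import Mathlib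

open Set Filter Topology Matrix
open scoped ContDiff ComplexOrder

noncomputable section

/-! ### Complex affine manifolds -/

/-- The pregroupoid of maps between open sets of `ℂⁿ` that near every point agree with a
complex affine map. -/
def affinePregroupoid (n : ℕ) : Pregroupoid (Fin n → ℂ) where
  property f s := ∀ x ∈ s, ∃ A : (Fin n → ℂ) →ᵃ[ℂ] (Fin n → ℂ), f =ᶠ[𝓝 x] A
  comp := by
    rintro f g u v hf hg - - - x ⟨hxu, hxv⟩
    obtain ⟨A, hA⟩ := hf x hxu
    obtain ⟨B, hB⟩ := hg (f x) hxv
    have hc : ContinuousAt f x :=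
      (A.continuous_of_finiteDimensional.continuousAt).congr hA.symm
    refine ⟨B.comp A, ?_⟩
    filter_upwards [hA, hc.eventually hB] with y h1 h2
    simp only [Function.comp_apply, AffineMap.coe_comp]
    rw [h2, h1]
  id_mem := fun _ _ => ⟨AffineMap.id ℂ _, Eventually.of_forall fun _ => rfl⟩
  locality := by
    intro f u _ h x hx
    obtain ⟨v, _, hxv, hv⟩ := h x hx
    exact hv x ⟨hx, hxv⟩
  congr := by
    intro f g u hu hfg hf x hx
    obtain ⟨A, hA⟩ := hf x hx
    refine ⟨A, ?_⟩
    filter_upwards [hA, hu.mem_nhds hx] with y h1 h2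
    rw [hfg y h2, h1]

/-- The structure groupoid of complex affine transition maps.  An `n`-dimensional complex affine
manifold is a space `V` with `[ChartedSpace (Fin n → ℂ) V] [HasGroupoid V (affineGroupoid n)]`. -/
def affineGroupoid (n : ℕ) : StructureGroupoid (Fin n → ℂ) :=
  (affinePregroupoid n).groupoid

section Tensors

variable {n : ℕ} {V : Type*} [TopologicalSpace V]

/-- Jacobian matrix at `x` of the change of coordinates from `e` (coordinates `z`) to `e'`
(coordinates `z'`): the entry `(μ, α)` is `∂z'^μ / ∂z^α`. -/
def transitionJacobian (e e' : OpenPartialHomeomorph V (Fin n → ℂ)) (x : V) :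
    Matrix (Fin n) (Fin n) ℂ :=
  Matrix.of fun μ α => fderiv ℂ (fun z => e' (e.symm z)) (e x) (Pi.single α 1) μ

/-- Entrywise complex conjugate of a matrix. -/
def conjMat {ι κ : Type*} (M : Matrix ι κ ℂ) : Matrix ι κ ℂ := M.map (starRingEnd ℂ)

variable [ChartedSpace (Fin n → ℂ) V]

/-- `S` is a constant (symmetric) section of `T*_{2,0}(V)`: in each chart `e` of the atlas it has
constant components `S e = (S_{αβ})`, and these obey the transformation law of a tensor
`S_{αβ} dz^α ⊗ dz^β`. -/
structure IsConstSection (S : OpenPartialHomeomorph V (Fin n → ℂ) → Matrix (Fin n) (Fin n) ℂ) :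
    Prop where
  symm : ∀ e ∈ atlas (Fin n → ℂ) V, (S e).IsSymm
  compat : ∀ e ∈ atlas (Fin n → ℂ) V, ∀ e' ∈ atlas (Fin n → ℂ) V, ∀ x ∈ e.source ∩ e'.source,
    S e = (transitionJacobian e e' x)ᵀ * S e' * transitionJacobian e e' x

/-- `b` is a Kähler metric `ω₀ = √-1 b_{αβ̄} dz^α ∧ dz̄^β` with constant coefficients: in each chart
`e` of the atlas its coefficients form a constant positive definite Hermitian matrix `b e`, and
these obey the transformation law of a `(1,1)`-form. -/
structure IsConstKahlerMetric
    (b : OpenPartialHomeomorph V (Fin n → ℂ) → Matrix (Fin n) (Fin n) ℂ) : Prop where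
  posDef : ∀ e ∈ atlas (Fin n → ℂ) V, (b e).PosDef
  compat : ∀ e ∈ atlas (Fin n → ℂ) V, ∀ e' ∈ atlas (Fin n → ℂ) V, ∀ x ∈ e.source ∩ e'.source,
    b e = (transitionJacobian e e' x)ᵀ * b e' * conjMat (transitionJacobian e e' x)

end Tensors

/-! ### Second order complex derivatives -/

section Derivatives

variable {X : Type*} [NormedAddCommGroup X] [NormedSpace ℝ X] [NormedSpace ℂ X]
  [IsScalarTower ℝ ℂ X]

/-- Second real derivative of `f` at `p` in the directions `u`, `v`. -/
def realHess (f : X → ℝ) (p u v : X) : ℝ := fderiv ℝ (fderiv ℝ f) p u v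

/-- `∂_u ∂̄_v f (p)`, where `∂_u = (D_u - i D_{iu}) / 2` and `∂̄_v = (D_v + i D_{iv}) / 2`. -/
def mixedDeriv (f : X → ℝ) (p u v : X) : ℂ :=
  (1 / 4 : ℂ) *
    (((realHess f p u v + realHess f p (Complex.I • u) (Complex.I • v) : ℝ) : ℂ)
      + Complex.I *
        ((realHess f p u (Complex.I • v) - realHess f p (Complex.I • u) v : ℝ) : ℂ))

/-- `∂_u ∂_v f (p)`, where `∂_u = (D_u - i D_{iu}) / 2`. -/
def pureDeriv (f : X → ℝ) (p u v : X) : ℂ :=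
  (1 / 4 : ℂ) *
    (((realHess f p u v - realHess f p (Complex.I • u) (Complex.I • v) : ℝ) : ℂ)
      - Complex.I *
        ((realHess f p u (Complex.I • v) + realHess f p (Complex.I • u) v : ℝ) : ℂ))

end Derivatives

section Convexity

variable {n : ℕ} {V : Type*} [TopologicalSpace V]

/-- The matrix `(φ_{αβ̄})` at `x` in the chart `e`. -/
def hessMixed (e : OpenPartialHomeomorph V (Fin n → ℂ)) (φ : V → ℝ) (x : V) :
    Matrix (Fin n) (Fin n) ℂ :=
  Matrix.of fun α β =>
    mixedDeriv (fun z => φ (e.symm z)) (e x) (Pi.single α (1 : ℂ)) (Pi.single β (1 : ℂ))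

/-- The matrix `(φ_{αβ})` at `x` in the chart `e`. -/
def hessPure (e : OpenPartialHomeomorph V (Fin n → ℂ)) (φ : V → ℝ) (x : V) :
    Matrix (Fin n) (Fin n) ℂ :=
  Matrix.of fun α β =>
    pureDeriv (fun z => φ (e.symm z)) (e x) (Pi.single α (1 : ℂ)) (Pi.single β (1 : ℂ))

/-- The matrix `B · conj(A⁻¹) · conj(B) · A⁻¹` of the endomorphism
`B_{αη} A^{ηγ̄} conj(B_{ργ}) A^{βρ̄} dz^α ⊗ ∂/∂z^β`.  For `A` positive definite Hermitian and `B`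
symmetric its eigenvalues are real and nonnegative. -/
def kMat (A B : Matrix (Fin n) (Fin n) ℂ) : Matrix (Fin n) (Fin n) ℂ :=
  B * conjMat A⁻¹ * conjMat B * A⁻¹

/-- The largest eigenvalue is `< c` (for a matrix with real eigenvalues). -/
def MaxEigenvalueLT (M : Matrix (Fin n) (Fin n) ℂ) (c : ℝ) : Prop :=
  ∀ μ : ℂ, Module.End.HasEigenvalue (Matrix.toLin' M) μ → μ.re < c

/-- The largest eigenvalue is `≤ c` (for a matrix with real eigenvalues). -/
def MaxEigenvalueLE (M : Matrix (Fin n) (Fin n) ℂ) (c : ℝ) : Prop :=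
  ∀ μ : ℂ, Module.End.HasEigenvalue (Matrix.toLin' M) μ → μ.re ≤ c

/-- Strict `(S, ω₀)`-convexity of a `C²` function `φ` on the domain of the chart `e`, where `b` and
`S` are the components of `ω₀` and `S` in `e`: `ω₀ + √-1 ∂∂̄φ > 0`, and with
`A = (b_{αβ̄} + φ_{αβ̄})` and `B = (φ_{αβ} + S_{αβ})` the largest eigenvalue of
`B · conj(A⁻¹) · conj(B) · A⁻¹` is `< 1`. -/
def IsStrictlyConvexOnChart (e : OpenPartialHomeomorph V (Fin n → ℂ))
    (b S : Matrix (Fin n) (Fin n) ℂ) (φ : V → ℝ) : Prop :=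
  ∀ x ∈ e.source, (b + hessMixed e φ x).PosDef ∧
    MaxEigenvalueLT (kMat (b + hessMixed e φ x) (hessPure e φ x + S)) 1

variable [ChartedSpace (Fin n → ℂ) V]

/-- `φ ∈ C²(V)`. -/
def IsC2 (n : ℕ) {V : Type*} [TopologicalSpace V] [ChartedSpace (Fin n → ℂ) V]
    (φ : V → ℝ) : Prop :=
  ∀ e ∈ atlas (Fin n → ℂ) V, ContDiffOn ℝ 2 (fun z => φ (e.symm z)) e.target

/-- `φ` is strictly `(S, ω₀)`-convex on `V`. -/
def IsStrictlyConvex (b S : OpenPartialHomeomorph V (Fin n → ℂ) → Matrix (Fin n) (Fin n) ℂ)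
    (φ : V → ℝ) : Prop :=
  ∀ e ∈ atlas (Fin n → ℂ) V, IsStrictlyConvexOnChart e (b e) (S e) φ

/-- `φ ∈ C²(V)` is `(S, ω₀)`-convex of degree `> δ`, tested with the constant sections `Θ` of
`T*_{2,0}(V)` over the whole of `V`. -/
def IsConvexOfGlobalDegreeGT
    (b S : OpenPartialHomeomorph V (Fin n → ℂ) → Matrix (Fin n) (Fin n) ℂ) (δ : ℝ)
    (φ : V → ℝ) : Prop :=
  IsC2 n φ ∧
    ∀ Θ : OpenPartialHomeomorph V (Fin n → ℂ) → Matrix (Fin n) (Fin n) ℂ, IsConstSection Θ →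
      (∀ e ∈ atlas (Fin n → ℂ) V, MaxEigenvalueLE (kMat (b e) (Θ e)) (δ ^ 2)) →
      IsStrictlyConvex b (S + Θ) φ

/-- `φ ∈ C²(V)` is `(S, ω₀)`-convex of degree `> δ`, tested in every chart with all constant
sections `Θ` of `T*_{2,0}` over the domain of that chart. -/
def IsConvexOfDegreeGT
    (b S : OpenPartialHomeomorph V (Fin n → ℂ) → Matrix (Fin n) (Fin n) ℂ) (δ : ℝ)
    (φ : V → ℝ) : Prop :=
  IsC2 n φ ∧
    ∀ e ∈ atlas (Fin n → ℂ) V, ∀ Θ : Matrix (Fin n) (Fin n) ℂ, Θ.IsSymm →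
      MaxEigenvalueLE (kMat (b e) Θ) (δ ^ 2) →
      IsStrictlyConvexOnChart e (b e) (S e + Θ) φ

/-- `ω₀ + √-1 ∂∂̄φ > δ ω₀`. -/
def MetricGT (b : OpenPartialHomeomorph V (Fin n → ℂ) → Matrix (Fin n) (Fin n) ℂ) (δ : ℝ)
    (φ : V → ℝ) : Prop :=
  ∀ e ∈ atlas (Fin n → ℂ) V, ∀ x ∈ e.source,
    (b e + hessMixed e φ x - (δ : ℂ) • b e).PosDef

end Convexity

/-! ### The perturbed Monge-Ampère problem -/

/-- A bounded domain in `ℂ` with smooth boundary: near every boundary point it is the negativity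
set of a smooth function with nonvanishing differential. -/
structure IsSmoothBoundedDomain (R : Set ℂ) : Prop where
  isOpen : IsOpen R
  isConnected : IsConnected R
  isBounded : Bornology.IsBounded R
  smooth_boundary : ∀ p ∈ frontier R, ∃ U : Set ℂ, IsOpen U ∧ p ∈ U ∧ ∃ ρ : ℂ → ℝ,
    ContDiffOn ℝ ∞ ρ U ∧ (∀ q ∈ U, fderiv ℝ ρ q ≠ 0) ∧ R ∩ U = {q ∈ U | ρ q < 0}

section Problem

variable {n : ℕ} {V : Type*} [TopologicalSpace V]

/-- The function `Φ` on `ℂ × V` in the coordinates `(τ, z)` given by the chart `e` of `V`. -/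
def inChart (e : OpenPartialHomeomorph V (Fin n → ℂ)) (Φ : ℂ → V → ℝ) :
    ℂ × (Fin n → ℂ) → ℝ :=
  fun q => Φ q.1 (e.symm q.2)

/-- Coordinate direction of `τ` in `ℂ × ℂⁿ`. -/
def dirτ (n : ℕ) : ℂ × (Fin n → ℂ) := (1, 0)

/-- Coordinate direction of `z^α` in `ℂ × ℂⁿ`. -/
def dirz (α : Fin n) : ℂ × (Fin n → ℂ) := (0, Pi.single α 1)

/-- The coefficient matrix of `Ω₀ + √-1 ∂∂̄Φ` at `(τ, x)` in the coordinates `(τ, z)`, where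
`Ω₀` is the pullback of `ω₀` to the product:
`((Φ_{ττ̄}, Φ_{τβ̄}), (Φ_{ατ̄}, Φ_{αβ̄} + b_{αβ̄}))`. -/
def productForm (e : OpenPartialHomeomorph V (Fin n → ℂ)) (b : Matrix (Fin n) (Fin n) ℂ)
    (Φ : ℂ → V → ℝ) (τ : ℂ) (x : V) : Matrix (Unit ⊕ Fin n) (Unit ⊕ Fin n) ℂ :=
  let H := mixedDeriv (inChart e Φ) (τ, e x)
  Matrix.fromBlocks
    (Matrix.of fun _ _ => H (dirτ n) (dirτ n))
    (Matrix.of fun _ β => H (dirτ n) (dirz β))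
    (Matrix.of fun α _ => H (dirz α) (dirτ n))
    (Matrix.of (fun α β => H (dirz α) (dirz β)) + b)

/-- The equation `Φ_{ττ̄} - Φ_{τβ̄} g^{αβ̄} Φ_{ατ̄} = ε b_{αβ̄} g^{αβ̄}` for the coefficient matrix
`M = ((Φ_{ττ̄}, Φ_{τβ̄}), (Φ_{ατ̄}, g_{αβ̄}))`; with `g = (g_{αβ̄})` one has `g^{αβ̄} = (g⁻¹)_{βα}`. -/
def PerturbedEquation (b : Matrix (Fin n) (Fin n) ℂ) (ε : ℝ)
    (M : Matrix (Unit ⊕ Fin n) (Unit ⊕ Fin n) ℂ) : Prop :=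
  M (Sum.inl ()) (Sum.inl ())
      - ∑ α, ∑ β, M (Sum.inl ()) (Sum.inr β) * (M.toBlocks₂₂)⁻¹ β α * M (Sum.inr α) (Sum.inl ())
    = (ε : ℂ) * ∑ α, ∑ β, b α β * (M.toBlocks₂₂)⁻¹ β α

variable [ChartedSpace (Fin n → ℂ) V]

/-- `Φ` is a (classical) solution, with boundary value `F`, of the elliptic perturbation of the
homogeneous complex Monge-Ampère equation on `R × V`. -/
structure IsSolution (R : Set ℂ)
    (b : OpenPartialHomeomorph V (Fin n → ℂ) → Matrix (Fin n) (Fin n) ℂ) (ε : ℝ)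
    (F Φ : ℂ → V → ℝ) : Prop where
  continuousOn : ContinuousOn (Function.uncurry Φ) (closure R ×ˢ univ)
  contDiffOn : ∀ e ∈ atlas (Fin n → ℂ) V, ContDiffOn ℝ 2 (inChart e Φ) (R ×ˢ e.target)
  equation : ∀ e ∈ atlas (Fin n → ℂ) V, ∀ τ ∈ R, ∀ x ∈ e.source,
    PerturbedEquation (b e) ε (productForm e (b e) Φ τ x)
  posDef : ∀ e ∈ atlas (Fin n → ℂ) V, ∀ τ ∈ R, ∀ x ∈ e.source,
    (productForm e (b e) Φ τ x).PosDef
  boundary : ∀ τ ∈ frontier R, ∀ x, Φ τ x = F τ x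

/-- `F ∈ C^∞(∂R × V)`. -/
def IsSmoothOnBoundary (n : ℕ) {V : Type*} [TopologicalSpace V] [ChartedSpace (Fin n → ℂ) V]
    (R : Set ℂ) (F : ℂ → V → ℝ) : Prop :=
  ∀ e ∈ atlas (Fin n → ℂ) V, ContDiffOn ℝ ∞ (inChart e F) (frontier R ×ˢ e.target)

/-- `Φ ∈ C⁴(R̄ × V)`. -/
def IsC4UpToBoundary (n : ℕ) {V : Type*} [TopologicalSpace V] [ChartedSpace (Fin n → ℂ) V]
    (R : Set ℂ) (Φ : ℂ → V → ℝ) : Prop :=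
  ∀ e ∈ atlas (Fin n → ℂ) V, ContDiffOn ℝ 4 (inChart e Φ) (closure R ×ˢ e.target)

/-- The curve `σ ↦ Ψ σ`, `σ ∈ [0, 1]`, is continuous in the `C²` topology of `R̄ × V`: all
derivatives up to order two depend continuously on `σ`, uniformly on `R̄ × K` for every compact
subset `K` of a coordinate domain. -/
def IsC2ContinuousCurve (n : ℕ) {V : Type*} [TopologicalSpace V] [ChartedSpace (Fin n → ℂ) V]
    (R : Set ℂ) (Ψ : ℝ → ℂ → V → ℝ) : Prop :=
  ∀ σ₀ ∈ Icc (0 : ℝ) 1, ∀ e ∈ atlas (Fin n → ℂ) V, ∀ K : Set (Fin n → ℂ), IsCompact K →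
    K ⊆ e.target → ∀ j : ℕ, j ≤ 2 →
      TendstoUniformlyOn
        (fun σ q => iteratedFDerivWithin ℝ j (inChart e (Ψ σ)) (closure R ×ˢ e.target) q)
        (fun q => iteratedFDerivWithin ℝ j (inChart e (Ψ σ₀)) (closure R ×ˢ e.target) q)
        (𝓝[Icc (0 : ℝ) 1] σ₀) (closure R ×ˢ K)

/-- The continuity-path assumption: for every `σ ∈ [0, 1]` the problem with boundary value `σ F`
has a solution `Ψ σ ∈ C⁴(R̄ × V)`, and `σ ↦ Ψ σ` is continuous in the `C²` topology. -/
def ContinuityPathAssumption (R : Set ℂ)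
    (b : OpenPartialHomeomorph V (Fin n → ℂ) → Matrix (Fin n) (Fin n) ℂ) (ε : ℝ)
    (F : ℂ → V → ℝ) : Prop :=
  ∃ Ψ : ℝ → ℂ → V → ℝ,
    (∀ σ ∈ Icc (0 : ℝ) 1,
      IsSolution R b ε (fun τ x => σ * F τ x) (Ψ σ) ∧ IsC4UpToBoundary n R (Ψ σ)) ∧
    IsC2ContinuousCurve n R Ψ

end Problem

end

/-! Strict `(S, ω₀)`-convexity is a statement about real Hessians. Since `½ D²φ(ξ,ξ) = φ_{αβ̄} ξ^α
ξ̄^β + Re φ_{αβ} ξ^α ξ^β`, it means that the real quadratic form `½ D²φ(ξ,ξ) + ω₀(ξ,ξ̄) + Re S(ξ,ξ)`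
is positive definite (`isStrictlyConvexOnChart_iff`). Over constant symmetric `Θ` with `Λ ≤ δ²`, the
least value of `Re Θ(ξ,ξ)` is `-δ ω₀(ξ,ξ̄)`, attained by a rank one `Θ`. Hence degree `> δ` says
that the form stays positive with `(1-δ) ω₀` in place of `ω₀`. Averaging that form over `ξ` and `iξ`
gives the metric lower bound. Global degree `> δ` is handled one section at a time, with `S + Θ` in
place of `S` and no loss in `ω₀`.

The core is a maximum principle for this form, `convexityForm_pos_of_nonneg`. Suppose that the form,
lowered by a barrier `κ (1+|τ|²) ω₀`, is nonnegative near an interior point and vanishes there on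
some `ξ ≠ 0`. Along a complex line in direction `(a, V)`, with `ξ` moved to `ξ + sζ`, its Laplacian
in `s` is nonnegative. Exchanging the order of differentiation turns that Laplacian into the second
derivative along `ξ` of the complex Hessian on `(a, V + tζ)`, minus terms from `β` and from the
barrier. By completion of squares, the equation says that a suitable sum of such Hessian values
equals a sum of squared residuals. The directions `V`, `E k` and their first-order corrections `ζ`,
`Z k` are chosen so that every residual is `o(t)`, so the weighted second derivatives add up to
zero. The barrier then makes the total negative, a contradiction.

The global argument is a continuity method. At `σ = 0` the solution is constant along `V`, so the
form is positive. On the boundary it is a convex combination of the hypothesis and `ω₀`. By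
compactness there would be a least bad `σ`, where the form is nonnegative and degenerates at an
interior point, which is impossible. A comparison principle identifies the given solution with the
end of the path. -/

noncomputable section

/-! ### Linear algebra: eigenvalues of `kMat` and real quadratic forms. -/

section HermitianForms

variable {n : ℕ}

/-- The real number `Re A_{αβ̄} ξ^α ξ̄^β`. -/
def hermForm (A : Matrix (Fin n) (Fin n) ℂ) (ξ : Fin n → ℂ) : ℝ := (ξ ⬝ᵥ A *ᵥ star ξ).re

/-- The real number `Re B_{αβ} ξ^α ξ^β`. -/
def symmForm (B : Matrix (Fin n) (Fin n) ℂ) (ξ : Fin n → ℂ) : ℝ := (ξ ⬝ᵥ B *ᵥ ξ).re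

lemma hermForm_pos {A : Matrix (Fin n) (Fin n) ℂ} (hA : A.PosDef) {ξ : Fin n → ℂ} (hξ : ξ ≠ 0) :
    0 < hermForm A ξ := by
  have h := hA.dotProduct_mulVec_pos (x := star ξ) (by simpa using hξ)
  rw [star_star] at h
  exact (Complex.lt_def.1 h).1

lemma hermForm_nonneg {A : Matrix (Fin n) (Fin n) ℂ} (hA : A.PosDef) (ξ : Fin n → ℂ) :
    0 ≤ hermForm A ξ := by
  by_cases hξ : ξ = 0
  · simp [hermForm, hξ]
  · exact (hermForm_pos hA hξ).le

lemma Matrix.IsHermitian.dotProduct_mulVec_comm {A : Matrix (Fin n) (Fin n) ℂ}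
    (hA : A.IsHermitian) (ξ η : Fin n → ℂ) :
    ξ ⬝ᵥ A *ᵥ star η = star (η ⬝ᵥ A *ᵥ star ξ) := by
  rw [← star_dotProduct_star, star_mulVec, star_star, hA.eq, dotProduct_mulVec]

lemma Matrix.IsHermitian.dotProduct_mulVec_im {A : Matrix (Fin n) (Fin n) ℂ}
    (hA : A.IsHermitian) (ξ : Fin n → ℂ) : (ξ ⬝ᵥ A *ᵥ star ξ).im = 0 := by
  have h := congrArg Complex.im (hA.dotProduct_mulVec_comm ξ ξ)
  simp only [RCLike.star_def, Complex.conj_im] at h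
  linarith

lemma posDef_of_hermForm_pos {A : Matrix (Fin n) (Fin n) ℂ} (hA : A.IsHermitian)
    (h : ∀ ξ : Fin n → ℂ, ξ ≠ 0 → 0 < hermForm A ξ) : A.PosDef := by
  refine PosDef.of_dotProduct_mulVec_pos hA fun x hx => ?_
  have h1 := h (star x) (by simpa using hx)
  have h2 := hA.dotProduct_mulVec_im (star x)
  rw [hermForm, star_star] at *
  rw [Complex.lt_def]
  exact ⟨h1, by simpa using h2.symm⟩

lemma Matrix.IsSymm.dotProduct_mulVec_comm {B : Matrix (Fin n) (Fin n) ℂ}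
    (hB : B.IsSymm) (ξ η : Fin n → ℂ) : ξ ⬝ᵥ B *ᵥ η = η ⬝ᵥ B *ᵥ ξ := by
  rw [dotProduct_mulVec, ← mulVec_transpose, hB.eq, dotProduct_comm]

lemma hermForm_smul (A : Matrix (Fin n) (Fin n) ℂ) (c : ℂ) (ξ : Fin n → ℂ) :
    hermForm A (c • ξ) = ‖c‖ ^ 2 * hermForm A ξ := by
  have h : (starRingEnd ℂ) c * c = ((‖c‖ ^ 2 : ℝ) : ℂ) := by
    rw [← Complex.normSq_eq_conj_mul_self, Complex.normSq_eq_norm_sq]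
  rw [hermForm, star_smul, mulVec_smul, dotProduct_smul, smul_dotProduct, smul_eq_mul, smul_eq_mul,
    ← mul_assoc, RCLike.star_def, h, Complex.re_ofReal_mul, hermForm]

lemma symmForm_smul (B : Matrix (Fin n) (Fin n) ℂ) (c : ℂ) (ξ : Fin n → ℂ) :
    symmForm B (c • ξ) = (c ^ 2 * (ξ ⬝ᵥ B *ᵥ ξ)).re := by
  rw [symmForm, mulVec_smul, dotProduct_smul, smul_dotProduct, smul_eq_mul, smul_eq_mul,
    ← mul_assoc, ← sq]

lemma symmForm_I_smul (B : Matrix (Fin n) (Fin n) ℂ) (ξ : Fin n → ℂ) :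
    symmForm B (Complex.I • ξ) = - symmForm B ξ := by
  rw [symmForm_smul, Complex.I_sq, neg_one_mul, Complex.neg_re, symmForm]

lemma hermForm_I_smul (B : Matrix (Fin n) (Fin n) ℂ) (ξ : Fin n → ℂ) :
    hermForm B (Complex.I • ξ) = hermForm B ξ := by
  rw [hermForm_smul]; simp

lemma hermForm_add_vec {A : Matrix (Fin n) (Fin n) ℂ} (hA : A.IsHermitian) (ξ η : Fin n → ℂ) :
    hermForm A (ξ + η) = hermForm A ξ + 2 * (η ⬝ᵥ A *ᵥ star ξ).re + hermForm A η := by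
  have h := congrArg Complex.re (hA.dotProduct_mulVec_comm ξ η)
  simp only [RCLike.star_def, Complex.conj_re] at h
  simp only [hermForm, star_add, mulVec_add, dotProduct_add, add_dotProduct, Complex.add_re]
  linarith

lemma symmForm_add_vec {B : Matrix (Fin n) (Fin n) ℂ} (hB : B.IsSymm) (ξ η : Fin n → ℂ) :
    symmForm B (ξ + η) = symmForm B ξ + 2 * (η ⬝ᵥ B *ᵥ ξ).re + symmForm B η := by
  have h := congrArg Complex.re (hB.dotProduct_mulVec_comm ξ η)
  simp only [symmForm, mulVec_add, dotProduct_add, add_dotProduct, Complex.add_re]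
  linarith

lemma hermForm_add (A B : Matrix (Fin n) (Fin n) ℂ) (ξ : Fin n → ℂ) :
    hermForm (A + B) ξ = hermForm A ξ + hermForm B ξ := by
  simp [hermForm, add_mulVec]

lemma symmForm_add (A B : Matrix (Fin n) (Fin n) ℂ) (ξ : Fin n → ℂ) :
    symmForm (A + B) ξ = symmForm A ξ + symmForm B ξ := by
  simp [symmForm, add_mulVec]

lemma hermForm_real_smul_mat (A : Matrix (Fin n) (Fin n) ℂ) (c : ℝ) (ξ : Fin n → ℂ) :
    hermForm ((c : ℂ) • A) ξ = c * hermForm A ξ := by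
  simp [hermForm, smul_mulVec]

lemma hermForm_sub (A B : Matrix (Fin n) (Fin n) ℂ) (ξ : Fin n → ℂ) :
    hermForm (A - B) ξ = hermForm A ξ - hermForm B ξ := by
  simp [hermForm, sub_mulVec]

@[fun_prop]
lemma continuous_hermForm (A : Matrix (Fin n) (Fin n) ℂ) : Continuous (hermForm A) := by
  unfold hermForm; fun_prop

@[fun_prop]
lemma continuous_symmForm (A : Matrix (Fin n) (Fin n) ℂ) : Continuous (symmForm A) := by
  unfold symmForm; fun_prop

lemma star_mulVec_conjMat (A : Matrix (Fin n) (Fin n) ℂ) (v : Fin n → ℂ) :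
    star (A *ᵥ v) = conjMat A *ᵥ star v := by
  ext i
  simp [conjMat, mulVec, dotProduct]

lemma conjMat_conjMat (A : Matrix (Fin n) (Fin n) ℂ) : conjMat (conjMat A) = A := by
  ext i j
  simp [conjMat]

lemma kMat_mulVec (A B : Matrix (Fin n) (Fin n) ℂ) (v : Fin n → ℂ) :
    kMat A B *ᵥ v = B *ᵥ star (A⁻¹ *ᵥ (B *ᵥ star (A⁻¹ *ᵥ v))) := by
  simp only [star_mulVec_conjMat, kMat, ← mulVec_mulVec, star_star, conjMat_conjMat]

/-- Write an eigenvector as `v = A ξ̄` and define `η` by `A η̄ = B ξ`, so that `B η = μ A ξ̄` and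
`A(η,η̄) = Re μ · A(ξ,ξ̄)`. Polarization of `B` at `ξ ± η`, bounded by `A` and the parallelogram
law, gives `A(η,η̄) < A(ξ,ξ̄)`. Replacing a vector by `i` times itself flips the sign of `B`, so the
one-sided hypothesis bounds `|Re B|`. -/
lemma maxEigenvalueLT_of_forall_pos {A B : Matrix (Fin n) (Fin n) ℂ} (hA : A.PosDef)
    (hB : B.IsSymm) (h : ∀ ξ : Fin n → ℂ, ξ ≠ 0 → 0 < hermForm A ξ + symmForm B ξ) :
    MaxEigenvalueLT (kMat A B) 1 := by
  intro μ hμ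
  obtain ⟨v, hv, hv0⟩ := hμ.exists_hasEigenvector
  rw [Module.End.mem_eigenspace_iff, toLin'_apply, kMat_mulVec] at hv
  have hdet : IsUnit A.det := (isUnit_iff_isUnit_det A).1 hA.isUnit
  set ξ := star (A⁻¹ *ᵥ v) with hξ
  have hAξ : A *ᵥ star ξ = v := by
    rw [hξ, star_star, mulVec_mulVec, mul_nonsing_inv _ hdet, one_mulVec]
  set η := star (A⁻¹ *ᵥ (B *ᵥ ξ)) with hη
  have hAη : A *ᵥ star η = B *ᵥ ξ := by
    rw [hη, star_star, mulVec_mulVec, mul_nonsing_inv _ hdet, one_mulVec]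
  have hξ0 : ξ ≠ 0 := by
    rintro h0
    rw [h0, star_zero, mulVec_zero] at hAξ
    exact hv0 hAξ.symm
  have h1 : ξ ⬝ᵥ B *ᵥ η = μ * (ξ ⬝ᵥ A *ᵥ star ξ) := by
    rw [hv, dotProduct_smul, hAξ, smul_eq_mul]
  have h2 : η ⬝ᵥ B *ᵥ ξ = η ⬝ᵥ A *ᵥ star η := by rw [hAη]
  have h3 : hermForm A η = μ.re * hermForm A ξ := by
    rw [hermForm, ← h2, ← hB.dotProduct_mulVec_comm, h1, Complex.mul_re,
      hA.isHermitian.dotProduct_mulVec_im, hermForm]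
    ring
  have h4 : (η ⬝ᵥ B *ᵥ ξ).re = hermForm A η := by rw [h2, hermForm]
  have hlt : ∀ ζ : Fin n → ℂ, ζ ≠ 0 → symmForm B ζ < hermForm A ζ := by
    intro ζ hζ
    have := h (Complex.I • ζ) (smul_ne_zero Complex.I_ne_zero hζ)
    rw [hermForm_I_smul, symmForm_I_smul] at this
    linarith
  have hle : ∀ ζ : Fin n → ℂ, symmForm B ζ ≤ hermForm A ζ ∧ 0 ≤ hermForm A ζ + symmForm B ζ := by
    intro ζ
    by_cases hζ : ζ = 0
    · simp [hζ, symmForm, hermForm]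
    · exact ⟨(hlt ζ hζ).le, (h ζ hζ).le⟩
  have e1 := hermForm_add_vec hA.isHermitian ξ η
  have e2 := hermForm_add_vec hA.isHermitian ξ (-η)
  have e3 := symmForm_add_vec hB ξ η
  have e4 := symmForm_add_vec hB ξ (-η)
  have e5 : hermForm A (-η) = hermForm A η := by simp [hermForm, mulVec_neg]
  have e6 : symmForm B (-η) = symmForm B η := by simp [symmForm, mulVec_neg]
  simp only [neg_dotProduct, Complex.neg_re, e5, e6] at e2 e4
  have hpos := hermForm_pos hA hξ0
  have key : hermForm A η < hermForm A ξ := by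
    -- The vectors `ξ + η` and `ξ - η` cannot both vanish, and strictness comes from a nonzero one.
    by_cases h0 : ξ + η = 0
    · have h0' : ξ + -η ≠ 0 := by
        intro h00
        have : (2 : ℂ) • ξ = 0 := by
          rw [two_smul]; linear_combination (exp := 1) h0 + h00
        exact hξ0 ((smul_eq_zero.1 this).resolve_left two_ne_zero)
      have := h _ h0'
      have := (hle (ξ + η)).1
      linarith
    · have := hlt _ h0
      have := (hle (ξ + -η)).2
      linarith
  nlinarith

lemma eq_zero_of_forall_dotProduct_re {w : Fin n → ℂ} (h : ∀ η : Fin n → ℂ, (η ⬝ᵥ w).re = 0) :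
    w = 0 := by
  have h1 := h (star w)
  have h2 : star w ⬝ᵥ w = ((∑ i, ‖w i‖ ^ 2 : ℝ) : ℂ) := by
    push_cast
    refine Finset.sum_congr rfl fun i _ => ?_
    simp [← Complex.conj_mul']
  rw [h2, Complex.ofReal_re, Finset.sum_eq_zero_iff_of_nonneg (fun i _ => by positivity)] at h1
  ext i
  simpa using h1 i (Finset.mem_univ i)

/-- Let `m` be the maximum of `Re B(ξ,ξ) / A(ξ,ξ̄)` over the unit sphere. The Euler–Lagrange
equation at a maximizer is `B ξ = m A ξ̄`, and applying it twice shows that `A ξ̄` is an eigenvector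
with eigenvalue `m²`. -/
lemma exists_hasEigenvalue_kMat {A B : Matrix (Fin n) (Fin n) ℂ} (hA : A.PosDef)
    (hB : B.IsSymm) {ξ₀ : Fin n → ℂ} (hξ₀ : ξ₀ ≠ 0) :
    ∃ m : ℝ, 0 ≤ m ∧ Module.End.HasEigenvalue (Matrix.toLin' (kMat A B)) ((m : ℂ) ^ 2) ∧
      ∀ ξ, |symmForm B ξ| ≤ m * hermForm A ξ := by
  have hcomp : IsCompact (Metric.sphere (0 : Fin n → ℂ) 1) := isCompact_sphere 0 1
  have hne : (Metric.sphere (0 : Fin n → ℂ) 1).Nonempty := by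
    refine ⟨((‖ξ₀‖⁻¹ : ℝ) : ℂ) • ξ₀, ?_⟩
    have : ‖ξ₀‖ ≠ 0 := norm_ne_zero_iff.2 hξ₀
    simp [norm_smul, this]
  have hne0 : ∀ ξ ∈ Metric.sphere (0 : Fin n → ℂ) 1, ξ ≠ 0 := by
    rintro ξ hξ rfl
    simp at hξ
  obtain ⟨ξ, hξ, hmax⟩ := hcomp.exists_isMaxOn hne
    (f := fun ξ => symmForm B ξ / hermForm A ξ)
    (ContinuousOn.div (by fun_prop) (by fun_prop) fun ξ hξ => (hermForm_pos hA (hne0 ξ hξ)).ne')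
  have hξ0 := hne0 ξ hξ
  have hpos := hermForm_pos hA hξ0
  set m := symmForm B ξ / hermForm A ξ with hm
  have hmξ : symmForm B ξ = m * hermForm A ξ := by rw [hm]; field_simp
  have hle : ∀ ζ : Fin n → ℂ, symmForm B ζ ≤ m * hermForm A ζ := by
    intro ζ
    by_cases hζ : ζ = 0
    · simp [hζ, symmForm, hermForm]
    have hnz : ‖ζ‖ ≠ 0 := norm_ne_zero_iff.2 hζ
    have h1 := hmax (a := ((‖ζ‖⁻¹ : ℝ) : ℂ) • ζ) (by simp [norm_smul, hnz])
    have h2 : hermForm A (((‖ζ‖⁻¹ : ℝ) : ℂ) • ζ) = ‖ζ‖⁻¹ ^ 2 * hermForm A ζ := by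
      rw [hermForm_smul]; simp
    have h3 : symmForm B (((‖ζ‖⁻¹ : ℝ) : ℂ) • ζ) = ‖ζ‖⁻¹ ^ 2 * symmForm B ζ := by
      rw [symmForm_smul, ← Complex.ofReal_pow, Complex.re_ofReal_mul, symmForm]
    have hp := hermForm_pos hA hζ
    simp only [mem_ofPred_eq, h2, h3] at h1
    rw [mul_div_mul_left _ _ (by positivity), div_le_iff₀ hp] at h1
    exact h1
  have habs : ∀ ζ, |symmForm B ζ| ≤ m * hermForm A ζ := by
    intro ζ
    rw [abs_le]
    have := hle (Complex.I • ζ)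
    rw [hermForm_I_smul, symmForm_I_smul] at this
    exact ⟨by linarith, hle ζ⟩
  have hm0 : 0 ≤ m := by
    have := (abs_nonneg _).trans (habs ξ)
    by_contra! hneg
    nlinarith
  refine ⟨m, hm0, ?_, habs⟩
  have hcrit : B *ᵥ ξ = (m : ℂ) • (A *ᵥ star ξ) := by
    rw [← sub_eq_zero]
    refine eq_zero_of_forall_dotProduct_re fun η => ?_
    -- Maximality along `ξ + tη` gives a nonnegative quadratic polynomial in `t` with zero constant
    -- term, so its linear coefficient vanishes.
    have hq : ∀ t : ℝ, 0 ≤ (m * hermForm A η - symmForm B η) * (t * t)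
        + (2 * (m * (η ⬝ᵥ A *ᵥ star ξ).re - (η ⬝ᵥ B *ᵥ ξ).re)) * t + 0 := by
      intro t
      have h1 := hle (ξ + (t : ℂ) • η)
      rw [hermForm_add_vec hA.isHermitian, symmForm_add_vec hB, hermForm_smul, symmForm_smul,
        ← Complex.ofReal_pow, Complex.re_ofReal_mul, smul_dotProduct, smul_dotProduct, smul_eq_mul,
        smul_eq_mul, Complex.re_ofReal_mul, Complex.re_ofReal_mul, Complex.norm_real,
        Real.norm_eq_abs, sq_abs, ← symmForm, hmξ] at h1
      nlinarith
    have hd := discrim_le_zero hq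
    rw [discrim, mul_zero, sub_zero] at hd
    have h0 := pow_eq_zero_iff (two_ne_zero) |>.1 (le_antisymm hd (sq_nonneg _))
    rw [dotProduct_sub, dotProduct_smul, Complex.sub_re, smul_eq_mul, Complex.re_ofReal_mul]
    linarith
  have hdet : IsUnit A.det := (isUnit_iff_isUnit_det A).1 hA.isUnit
  refine Module.End.hasEigenvalue_of_hasEigenvector (x := A *ᵥ star ξ) ⟨?_, ?_⟩
  · rw [Module.End.mem_eigenspace_iff, toLin'_apply, kMat_mulVec, mulVec_mulVec _ A⁻¹ A,
      nonsing_inv_mul _ hdet, one_mulVec, star_star, hcrit, mulVec_smul, mulVec_mulVec _ A⁻¹ A,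
      nonsing_inv_mul _ hdet, one_mulVec, star_smul, star_star, mulVec_smul, hcrit, smul_smul]
    simp [sq]
  · intro h0
    simp [hermForm, h0] at hpos

lemma abs_symmForm_lt_of_maxEigenvalueLT {A B : Matrix (Fin n) (Fin n) ℂ} (hA : A.PosDef)
    (hB : B.IsSymm) (h : MaxEigenvalueLT (kMat A B) 1) {ξ : Fin n → ℂ} (hξ : ξ ≠ 0) :
    |symmForm B ξ| < hermForm A ξ := by
  obtain ⟨m, hm, hev, hle⟩ := exists_hasEigenvalue_kMat hA hB hξ
  have h1 := h _ hev
  rw [← Complex.ofReal_pow, Complex.ofReal_re] at h1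
  have h2 : m < 1 := by nlinarith
  have := hermForm_pos hA hξ
  nlinarith [hle ξ]

lemma abs_symmForm_le_of_maxEigenvalueLE {A B : Matrix (Fin n) (Fin n) ℂ} (hA : A.PosDef)
    (hB : B.IsSymm) {δ : ℝ} (hδ : 0 ≤ δ) (h : MaxEigenvalueLE (kMat A B) (δ ^ 2))
    (ξ : Fin n → ℂ) : |symmForm B ξ| ≤ δ * hermForm A ξ := by
  by_cases hξ : ξ = 0
  · simp [hξ, symmForm, hermForm]
  obtain ⟨m, hm, hev, hle⟩ := exists_hasEigenvalue_kMat hA hB hξ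
  have h1 := h _ hev
  rw [← Complex.ofReal_pow, Complex.ofReal_re] at h1
  have h2 : m ≤ δ := le_of_sq_le_sq h1 hδ
  exact (hle ξ).trans (mul_le_mul_of_nonneg_right h2 (hermForm_nonneg hA ξ))

/-- A symmetric matrix of rank one that attains the bound of `abs_symmForm_le_of_maxEigenvalueLE`
in a given direction. -/
lemma exists_symm_attaining {A : Matrix (Fin n) (Fin n) ℂ} (hA : A.PosDef) {δ : ℝ}
    {ξ : Fin n → ℂ} (hξ : ξ ≠ 0) :
    ∃ Θ : Matrix (Fin n) (Fin n) ℂ, Θ.IsSymm ∧ MaxEigenvalueLE (kMat A Θ) (δ ^ 2) ∧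
      symmForm Θ ξ = -(δ * hermForm A ξ) := by
  set u := A *ᵥ star ξ with hu
  have hpos := hermForm_pos hA hξ
  set a := hermForm A ξ with ha
  have hξu : ξ ⬝ᵥ u = (a : ℂ) := by
    apply Complex.ext
    · rw [ha, hermForm, Complex.ofReal_re]
    · rw [hA.isHermitian.dotProduct_mulVec_im, Complex.ofReal_im]
  have hΘ : ∀ w, ((-(δ / a : ℝ) : ℂ) • vecMulVec u u) *ᵥ w = (-(δ / a : ℝ) * (u ⬝ᵥ w) : ℂ) • u := by
    intro w
    rw [smul_mulVec, vecMulVec_mulVec, op_smul_eq_smul, smul_smul]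
  have hdet : IsUnit A.det := (isUnit_iff_isUnit_det A).1 hA.isUnit
  have hau : A⁻¹ *ᵥ u = star ξ := by
    rw [hu, mulVec_mulVec, nonsing_inv_mul _ hdet, one_mulVec]
  have ha0 : (a : ℂ) ≠ 0 := by exact_mod_cast hpos.ne'
  -- With `u = A ξ̄` and `a = A(ξ,ξ̄)`, the range of `kMat` lies on the line through `u`, where it
  -- acts as multiplication by `δ²`. Also `ξ ⬝ᵥ u = a` makes the value on `ξ` equal to `-δ a`.
  refine ⟨(-(δ / a : ℝ) : ℂ) • vecMulVec u u, ?_, ?_, ?_⟩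
  · rw [IsSymm, transpose_smul, transpose_vecMulVec]
  · intro μ hμ
    obtain ⟨v, hv, hv0⟩ := hμ.exists_hasEigenvector
    rw [Module.End.mem_eigenspace_iff, toLin'_apply, kMat_mulVec] at hv
    simp only [hΘ, mulVec_smul, star_smul, dotProduct_smul, hau, star_star] at hv
    rw [dotProduct_comm u ξ, hξu] at hv
    by_cases hμ0 : μ = 0
    · rw [hμ0]; simpa using sq_nonneg δ
    obtain ⟨c, hc⟩ : ∃ c : ℂ, v = c • u := by
      obtain ⟨k, hk⟩ : ∃ k : ℂ, k • u = μ • v := ⟨_, hv⟩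
      exact ⟨μ⁻¹ * k, by rw [mul_smul, hk, smul_smul, inv_mul_cancel₀ hμ0, one_smul]⟩
    have hc0 : c ≠ 0 := by rintro rfl; simp at hc; exact hv0 hc
    have hu0 : u ≠ 0 := by rintro h0; rw [h0] at hc; simp at hc; exact hv0 hc
    have hdot : u ⬝ᵥ star (A⁻¹ *ᵥ v) = star c * a := by
      rw [hc, mulVec_smul, hau, star_smul, star_star, dotProduct_smul, dotProduct_comm, hξu,
        smul_eq_mul]
    rw [hdot, hc, smul_smul] at hv
    have h1 := smul_left_injective ℂ hu0 hv
    have h2 : μ = (δ : ℂ) ^ 2 := by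
      apply mul_right_cancel₀ hc0
      simp only [smul_eq_mul, star_mul', star_neg, RCLike.star_def, Complex.conj_conj,
        Complex.conj_ofReal] at h1
      rw [← h1]
      push_cast
      field_simp
    rw [h2, ← Complex.ofReal_pow, Complex.ofReal_re]
  · rw [symmForm, hΘ, dotProduct_smul, dotProduct_comm u ξ, hξu, smul_eq_mul]
    norm_cast
    field_simp

end HermitianForms

/-! ### The equation as a prescribed Schur complement. -/

section SchurComplement

variable {n : ℕ}

lemma hermForm_star (A : Matrix (Fin n) (Fin n) ℂ) (w : Fin n → ℂ) :
    hermForm A (star w) = (star w ⬝ᵥ A *ᵥ w).re := by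
  rw [hermForm, star_star]

/-- Completion of the square. -/
lemma hermForm_inv_add {g : Matrix (Fin n) (Fin n) ℂ} (hg : g.PosDef) (V c : Fin n → ℂ) :
    hermForm g⁻¹ (star (g *ᵥ star V + c)) =
      hermForm g V + 2 * (V ⬝ᵥ c).re + hermForm g⁻¹ (star c) := by
  have hdet : IsUnit g.det := (isUnit_iff_isUnit_det g).1 hg.isUnit
  have h1 : g⁻¹ *ᵥ (g *ᵥ star V) = star V := by
    rw [mulVec_mulVec, nonsing_inv_mul _ hdet, one_mulVec]
  have h2 : star (g *ᵥ star V) ⬝ᵥ (g⁻¹ *ᵥ c) = V ⬝ᵥ c := by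
    rw [star_mulVec, star_star, hg.isHermitian.eq, ← dotProduct_mulVec, mulVec_mulVec,
      mul_nonsing_inv _ hdet, one_mulVec]
  have h3 : (star (g *ᵥ star V) ⬝ᵥ star V).re = hermForm g V := by
    rw [star_mulVec, star_star, hg.isHermitian.eq, ← dotProduct_mulVec, hermForm]
  have h4 : (star c ⬝ᵥ star V).re = (V ⬝ᵥ c).re := by
    rw [star_dotProduct_star, RCLike.star_def, Complex.conj_re]
  rw [hermForm_star, hermForm_star, star_add, mulVec_add, h1, dotProduct_add, add_dotProduct,
    add_dotProduct, h2, Complex.add_re, Complex.add_re, Complex.add_re, h3, h4]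
  ring

/-- By completion of the square, the inverse form at `c` is the maximum over `V` of `-(g(V,V̄) + 2
Re V·c)`. A larger `g` therefore has a smaller inverse form. The chosen `V` is the maximizer for
`B`. -/
lemma hermForm_inv_anti {A B : Matrix (Fin n) (Fin n) ℂ} (hA : A.PosDef) (hB : B.PosDef)
    (h : ∀ ξ, hermForm A ξ ≤ hermForm B ξ) (c : Fin n → ℂ) :
    hermForm B⁻¹ (star c) ≤ hermForm A⁻¹ (star c) := by
  have hdet : IsUnit B.det := (isUnit_iff_isUnit_det B).1 hB.isUnit
  set V : Fin n → ℂ := star (-(B⁻¹ *ᵥ c)) with hV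
  have h1 : B *ᵥ star V = -c := by
    rw [hV, star_star, mulVec_neg, mulVec_mulVec, mul_nonsing_inv _ hdet, one_mulVec]
  have h2 := hermForm_inv_add hB V c
  have h3 := hermForm_inv_add hA V c
  have h4 := hermForm_nonneg hA.inv (star (A *ᵥ star V + c))
  have h5 := h V
  rw [h1, neg_add_cancel, star_zero] at h2
  have h6 : hermForm B⁻¹ 0 = 0 := by simp [hermForm]
  linarith

/-- `Re b_{αβ̄} g^{αβ̄}`. -/
def traceInv (b g : Matrix (Fin n) (Fin n) ℂ) : ℝ := (∑ α, ∑ β, b α β * g⁻¹ β α).re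

/-- Factoring the background metric as `C Cᴴ` reduces the trace to values of the inverse form on the
columns of `C`, where completion of the square applies. -/
lemma traceInv_eq_sum {C g : Matrix (Fin n) (Fin n) ℂ} :
    traceInv (C * Cᴴ) g = ∑ k, hermForm g⁻¹ (star (Cᵀ k)) := by
  simp only [hermForm_star]
  rw [traceInv, ← Complex.re_sum]
  congr 1
  simp only [mul_apply, dotProduct, mulVec, Finset.sum_mul, Finset.mul_sum, conjTranspose_apply,
    transpose_apply, Pi.star_apply]
  calc ∑ α, ∑ β, ∑ k, C α k * star (C β k) * g⁻¹ β α
      = ∑ α, ∑ k, ∑ β, C α k * star (C β k) * g⁻¹ β α :=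
        Finset.sum_congr rfl fun _ _ => Finset.sum_comm
    _ = ∑ k, ∑ α, ∑ β, C α k * star (C β k) * g⁻¹ β α := Finset.sum_comm
    _ = _ := by
        refine Finset.sum_congr rfl fun k _ => ?_
        rw [Finset.sum_comm]
        refine Finset.sum_congr rfl fun β _ => Finset.sum_congr rfl fun α _ => ?_
        ring

lemma exists_eq_mul_conjTranspose {b : Matrix (Fin n) (Fin n) ℂ} (hb : b.PosDef) :
    ∃ C : Matrix (Fin n) (Fin n) ℂ, b = C * Cᴴ := by
  open scoped MatrixOrder in
  obtain ⟨B, hB⟩ := CStarAlgebra.nonneg_iff_eq_star_mul_self.mp hb.posSemidef.nonneg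
  exact ⟨Bᴴ, by rw [conjTranspose_conjTranspose]; exact hB⟩

lemma traceInv_anti {b A B : Matrix (Fin n) (Fin n) ℂ} (hb : b.PosDef) (hA : A.PosDef)
    (hB : B.PosDef) (h : ∀ ξ, hermForm A ξ ≤ hermForm B ξ) : traceInv b B ≤ traceInv b A := by
  obtain ⟨C, rfl⟩ := exists_eq_mul_conjTranspose hb
  rw [traceInv_eq_sum, traceInv_eq_sum]
  exact Finset.sum_le_sum fun k _ => hermForm_inv_anti hA hB h _

lemma traceInv_self {b : Matrix (Fin n) (Fin n) ℂ} (hb : b.PosDef) : traceInv b b = n := by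
  have hdet : IsUnit b.det := (isUnit_iff_isUnit_det b).1 hb.isUnit
  have : ∑ α, ∑ β, b α β * b⁻¹ β α = (b * b⁻¹).trace := by
    simp [trace, mul_apply]
  rw [traceInv, this, mul_nonsing_inv _ hdet, trace_one, Fintype.card_fin, Complex.natCast_re]

/-- The value of the form with matrix `M` on the vector `(1, V)`. -/
def lineForm (M : Matrix (Unit ⊕ Fin n) (Unit ⊕ Fin n) ℂ) (V : Fin n → ℂ) : ℝ :=
  (M (Sum.inl ()) (Sum.inl ())).re + 2 * (V ⬝ᵥ fun α => M (Sum.inr α) (Sum.inl ())).re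
    + hermForm M.toBlocks₂₂ V

lemma posDef_toBlocks₂₂ {M : Matrix (Unit ⊕ Fin n) (Unit ⊕ Fin n) ℂ} (hM : M.PosDef) :
    M.toBlocks₂₂.PosDef := hM.submatrix Sum.inr_injective

/-- The equation says that the Schur complement of `g` in `M` is `ε` times the trace. The Schur
complement is the minimum over `V` of the form on `(1, V)`, and the remainder is the square of the
residual `g V̄ + c`. -/
lemma lineForm_eq {M : Matrix (Unit ⊕ Fin n) (Unit ⊕ Fin n) ℂ} (hM : M.PosDef)
    {b : Matrix (Fin n) (Fin n) ℂ} {ε : ℝ} (h : PerturbedEquation b ε M) (V : Fin n → ℂ) :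
    lineForm M V = ε * traceInv b M.toBlocks₂₂ + hermForm (M.toBlocks₂₂)⁻¹
      (star (M.toBlocks₂₂ *ᵥ star V + fun α => M (Sum.inr α) (Sum.inl ()))) := by
  rw [hermForm_inv_add (posDef_toBlocks₂₂ hM), lineForm]
  have h1 := congrArg Complex.re h
  rw [Complex.re_ofReal_mul, ← traceInv, Complex.sub_re] at h1
  have h2 : (∑ α, ∑ β, M (Sum.inl ()) (Sum.inr β) * (M.toBlocks₂₂)⁻¹ β α *
      M (Sum.inr α) (Sum.inl ())).re
      = hermForm (M.toBlocks₂₂)⁻¹ (star fun α => M (Sum.inr α) (Sum.inl ())) := by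
    rw [hermForm_star, Finset.sum_comm]
    simp only [dotProduct, mulVec, Finset.mul_sum, Pi.star_apply]
    congr 1
    refine Finset.sum_congr rfl fun β _ => Finset.sum_congr rfl fun α _ => ?_
    rw [← hM.isHermitian.apply (Sum.inl ()) (Sum.inr β)]
    ring
  linarith

lemma le_lineForm {M : Matrix (Unit ⊕ Fin n) (Unit ⊕ Fin n) ℂ} (hM : M.PosDef)
    {b : Matrix (Fin n) (Fin n) ℂ} {ε : ℝ} (h : PerturbedEquation b ε M) (V : Fin n → ℂ) :
    ε * traceInv b M.toBlocks₂₂ ≤ lineForm M V := by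
  rw [lineForm_eq hM h]
  have := hermForm_nonneg (posDef_toBlocks₂₂ hM).inv
    (star (M.toBlocks₂₂ *ᵥ star V + fun α => M (Sum.inr α) (Sum.inl ())))
  linarith

lemma exists_lineForm_eq {M : Matrix (Unit ⊕ Fin n) (Unit ⊕ Fin n) ℂ} (hM : M.PosDef)
    {b : Matrix (Fin n) (Fin n) ℂ} {ε : ℝ} (h : PerturbedEquation b ε M) :
    ∃ V, lineForm M V = ε * traceInv b M.toBlocks₂₂ := by
  have hg := posDef_toBlocks₂₂ hM
  have hdet : IsUnit M.toBlocks₂₂.det := (isUnit_iff_isUnit_det _).1 hg.isUnit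
  refine ⟨star (-((M.toBlocks₂₂)⁻¹ *ᵥ fun α => M (Sum.inr α) (Sum.inl ()))), ?_⟩
  rw [lineForm_eq hM h, star_star, mulVec_neg, mulVec_mulVec, mul_nonsing_inv _ hdet, one_mulVec,
    neg_add_cancel, star_zero]
  simp [hermForm]

end SchurComplement

/-! ### Sesquilinearity and symmetry of complex second derivatives. -/

section HessianAlgebra

set_option linter.unusedSectionVars false

variable {X : Type*} [NormedAddCommGroup X] [NormedSpace ℝ X] [NormedSpace ℂ X]
  [IsScalarTower ℝ ℂ X] (f : X → ℝ) (p : X)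

lemma realHess_complex_smul_left (c : ℂ) (u v : X) :
    realHess f p (c • u) v = c.re * realHess f p u v + c.im * realHess f p (Complex.I • u) v := by
  have h : c • u = c.re • u + c.im • (Complex.I • u) := by
    conv_lhs => rw [← Complex.re_add_im c, add_smul, mul_smul]
    rw [← algebraMap_smul ℂ c.re, ← algebraMap_smul ℂ c.im]
    rfl
  simp [realHess, h]

lemma realHess_complex_smul_right (c : ℂ) (u v : X) :
    realHess f p u (c • v) = c.re * realHess f p u v + c.im * realHess f p u (Complex.I • v) := by
  have h : c • v = c.re • v + c.im • (Complex.I • v) := by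
    conv_lhs => rw [← Complex.re_add_im c, add_smul, mul_smul]
    rw [← algebraMap_smul ℂ c.re, ← algebraMap_smul ℂ c.im]
    rfl
  simp [realHess, h]

lemma I_smul_I_smul (u : X) : Complex.I • Complex.I • u = -u := by
  rw [smul_smul, Complex.I_mul_I, neg_one_smul]

lemma mixedDeriv_add_left (u u' v : X) :
    mixedDeriv f p (u + u') v = mixedDeriv f p u v + mixedDeriv f p u' v := by
  simp only [mixedDeriv, realHess, smul_add, map_add, _root_.add_apply]
  push_cast
  ring

lemma mixedDeriv_add_right (u v v' : X) :
    mixedDeriv f p u (v + v') = mixedDeriv f p u v + mixedDeriv f p u v' := by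
  simp only [mixedDeriv, realHess, smul_add, map_add]
  push_cast
  ring

lemma realHess_neg_left (u v : X) : realHess f p (-u) v = - realHess f p u v := by
  simp [realHess]

lemma realHess_neg_right (u v : X) : realHess f p u (-v) = - realHess f p u v := by
  simp [realHess]

lemma mixedDeriv_smul_left (c : ℂ) (u v : X) :
    mixedDeriv f p (c • u) v = c * mixedDeriv f p u v := by
  rw [mixedDeriv, mixedDeriv, smul_comm Complex.I c]
  simp only [realHess_complex_smul_left f p c, I_smul_I_smul, realHess_neg_left]
  apply Complex.ext <;> simp <;> ring

lemma mixedDeriv_smul_right (c : ℂ) (u v : X) :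
    mixedDeriv f p u (c • v) = star c * mixedDeriv f p u v := by
  rw [mixedDeriv, mixedDeriv, smul_comm Complex.I c]
  simp only [realHess_complex_smul_right f p c, I_smul_I_smul, realHess_neg_right]
  apply Complex.ext <;> simp <;> ring

lemma pureDeriv_add_left (u u' v : X) :
    pureDeriv f p (u + u') v = pureDeriv f p u v + pureDeriv f p u' v := by
  simp only [pureDeriv, realHess, smul_add, map_add, _root_.add_apply]
  push_cast
  ring

lemma pureDeriv_add_right (u v v' : X) :
    pureDeriv f p u (v + v') = pureDeriv f p u v + pureDeriv f p u v' := by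
  simp only [pureDeriv, realHess, smul_add, map_add]
  push_cast
  ring

lemma pureDeriv_smul_left (c : ℂ) (u v : X) :
    pureDeriv f p (c • u) v = c * pureDeriv f p u v := by
  rw [pureDeriv, pureDeriv, smul_comm Complex.I c]
  simp only [realHess_complex_smul_left f p c, I_smul_I_smul, realHess_neg_left]
  apply Complex.ext <;> simp <;> ring

lemma pureDeriv_smul_right (c : ℂ) (u v : X) :
    pureDeriv f p u (c • v) = c * pureDeriv f p u v := by
  rw [pureDeriv, pureDeriv, smul_comm Complex.I c]
  simp only [realHess_complex_smul_right f p c, I_smul_I_smul, realHess_neg_right]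
  apply Complex.ext <;> simp <;> ring

lemma mixedDeriv_sum_left {ι : Type*} (s : Finset ι) (a : ι → ℂ) (u : ι → X) (v : X) :
    mixedDeriv f p (∑ i ∈ s, a i • u i) v = ∑ i ∈ s, a i * mixedDeriv f p (u i) v := by
  classical
  induction s using Finset.induction_on with
  | empty => simp [mixedDeriv, realHess]
  | insert i s hi ih =>
    rw [Finset.sum_insert hi, Finset.sum_insert hi, mixedDeriv_add_left, mixedDeriv_smul_left, ih]

lemma mixedDeriv_sum_right {ι : Type*} (s : Finset ι) (a : ι → ℂ) (u : X) (v : ι → X) :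
    mixedDeriv f p u (∑ i ∈ s, a i • v i) = ∑ i ∈ s, star (a i) * mixedDeriv f p u (v i) := by
  classical
  induction s using Finset.induction_on with
  | empty => simp [mixedDeriv, realHess]
  | insert i s hi ih =>
    rw [Finset.sum_insert hi, Finset.sum_insert hi, mixedDeriv_add_right, mixedDeriv_smul_right, ih]

lemma pureDeriv_sum_left {ι : Type*} (s : Finset ι) (a : ι → ℂ) (u : ι → X) (v : X) :
    pureDeriv f p (∑ i ∈ s, a i • u i) v = ∑ i ∈ s, a i * pureDeriv f p (u i) v := by
  classical
  induction s using Finset.induction_on with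
  | empty => simp [pureDeriv, realHess]
  | insert i s hi ih =>
    rw [Finset.sum_insert hi, Finset.sum_insert hi, pureDeriv_add_left, pureDeriv_smul_left, ih]

lemma pureDeriv_sum_right {ι : Type*} (s : Finset ι) (a : ι → ℂ) (u : X) (v : ι → X) :
    pureDeriv f p u (∑ i ∈ s, a i • v i) = ∑ i ∈ s, a i * pureDeriv f p u (v i) := by
  classical
  induction s using Finset.induction_on with
  | empty => simp [pureDeriv, realHess]
  | insert i s hi ih =>
    rw [Finset.sum_insert hi, Finset.sum_insert hi, pureDeriv_add_right, pureDeriv_smul_right, ih]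

lemma mixedDeriv_self_re (u : X) :
    (mixedDeriv f p u u).re =
      1 / 4 * (realHess f p u u + realHess f p (Complex.I • u) (Complex.I • u)) := by
  simp [mixedDeriv]

lemma pureDeriv_self_re (u : X) :
    (pureDeriv f p u u).re =
      1 / 4 * (realHess f p u u - realHess f p (Complex.I • u) (Complex.I • u)) := by
  simp [pureDeriv]

variable {f p}

lemma realHess_comm (hf : ContDiffAt ℝ 2 f p) (u v : X) :
    realHess f p u v = realHess f p v u :=
  hf.isSymmSndFDerivAt (by simp) u v

lemma mixedDeriv_conj (hf : ContDiffAt ℝ 2 f p) (u v : X) :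
    star (mixedDeriv f p u v) = mixedDeriv f p v u := by
  rw [mixedDeriv, mixedDeriv, realHess_comm hf v u, realHess_comm hf (Complex.I • v),
    realHess_comm hf v, realHess_comm hf (Complex.I • v) u]
  apply Complex.ext <;> simp

lemma pureDeriv_comm (hf : ContDiffAt ℝ 2 f p) (u v : X) :
    pureDeriv f p u v = pureDeriv f p v u := by
  rw [pureDeriv, pureDeriv, realHess_comm hf v u, realHess_comm hf (Complex.I • v),
    realHess_comm hf v, realHess_comm hf (Complex.I • v) u]
  apply Complex.ext
  · simp
  · simp; ring

end HessianAlgebra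

/-! ### Coefficient matrices evaluated on vectors. -/

section CoefficientMatrices

variable {n : ℕ}

lemma sum_smul_single (ξ : Fin n → ℂ) : ∑ α, ξ α • (Pi.single α (1 : ℂ) : Fin n → ℂ) = ξ := by
  simpa using (pi_eq_sum_univ' ξ).symm

lemma hermForm_of_mixedDeriv {X : Type*} [NormedAddCommGroup X] [NormedSpace ℝ X]
    [NormedSpace ℂ X] [IsScalarTower ℝ ℂ X] (f : X → ℝ) (p : X) (v : Fin n → X) (ξ : Fin n → ℂ) :
    hermForm (Matrix.of fun α β => mixedDeriv f p (v α) (v β)) ξ =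
      (mixedDeriv f p (∑ α, ξ α • v α) (∑ α, ξ α • v α)).re := by
  rw [mixedDeriv_sum_left, hermForm]
  simp only [mixedDeriv_sum_right, dotProduct, mulVec, of_apply, Pi.star_apply]
  congr 1
  refine Finset.sum_congr rfl fun α _ => ?_
  congr 1
  exact Finset.sum_congr rfl fun β _ => mul_comm _ _

lemma symmForm_of_pureDeriv {X : Type*} [NormedAddCommGroup X] [NormedSpace ℝ X]
    [NormedSpace ℂ X] [IsScalarTower ℝ ℂ X] (f : X → ℝ) (p : X) (v : Fin n → X) (ξ : Fin n → ℂ) :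
    symmForm (Matrix.of fun α β => pureDeriv f p (v α) (v β)) ξ =
      (pureDeriv f p (∑ α, ξ α • v α) (∑ α, ξ α • v α)).re := by
  rw [pureDeriv_sum_left, symmForm]
  simp only [pureDeriv_sum_right, dotProduct, mulVec, of_apply]
  congr 1
  refine Finset.sum_congr rfl fun α _ => ?_
  congr 1
  exact Finset.sum_congr rfl fun β _ => mul_comm _ _

/-- The bridge from the complex notion of convexity to real Hessians: the mixed part averages `D²φ`
over `ξ` and `iξ`, the pure part takes half their difference, and the sum retains only the `ξ` term.
-/
lemma hermForm_hessMixed_add_symmForm_hessPure {V : Type*} [TopologicalSpace V]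
    (e : OpenPartialHomeomorph V (Fin n → ℂ)) (φ : V → ℝ) (x : V) (ξ : Fin n → ℂ) :
    hermForm (hessMixed e φ x) ξ + symmForm (hessPure e φ x) ξ =
      1 / 2 * realHess (fun z => φ (e.symm z)) (e x) ξ ξ := by
  rw [hessMixed, hessPure, hermForm_of_mixedDeriv, symmForm_of_pureDeriv, sum_smul_single,
    mixedDeriv_self_re, pureDeriv_self_re]
  ring

lemma isHermitian_hessMixed {V : Type*} [TopologicalSpace V]
    {e : OpenPartialHomeomorph V (Fin n → ℂ)} {φ : V → ℝ} {x : V}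
    (h : ContDiffAt ℝ 2 (fun z => φ (e.symm z)) (e x)) : (hessMixed e φ x).IsHermitian := by
  ext α β
  rw [conjTranspose_apply]
  exact mixedDeriv_conj h _ _

lemma isSymm_hessPure {V : Type*} [TopologicalSpace V]
    {e : OpenPartialHomeomorph V (Fin n → ℂ)} {φ : V → ℝ} {x : V}
    (h : ContDiffAt ℝ 2 (fun z => φ (e.symm z)) (e x)) : (hessPure e φ x).IsSymm := by
  ext α β
  rw [transpose_apply]
  exact pureDeriv_comm h _ _

/-- The coefficient matrix of `Ω₀ + √-1 ∂∂̄f` for a function `f` of the coordinates `(τ, z)`. -/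
def coordForm (f : ℂ × (Fin n → ℂ) → ℝ) (b : Matrix (Fin n) (Fin n) ℂ) (q : ℂ × (Fin n → ℂ)) :
    Matrix (Unit ⊕ Fin n) (Unit ⊕ Fin n) ℂ :=
  Matrix.fromBlocks
    (Matrix.of fun _ _ => mixedDeriv f q (dirτ n) (dirτ n))
    (Matrix.of fun _ β => mixedDeriv f q (dirτ n) (dirz β))
    (Matrix.of fun α _ => mixedDeriv f q (dirz α) (dirτ n))
    (Matrix.of (fun α β => mixedDeriv f q (dirz α) (dirz β)) + b)

lemma productForm_eq_coordForm {V : Type*} [TopologicalSpace V]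
    (e : OpenPartialHomeomorph V (Fin n → ℂ)) (b : Matrix (Fin n) (Fin n) ℂ) (Φ : ℂ → V → ℝ)
    (τ : ℂ) (x : V) : productForm e b Φ τ x = coordForm (inChart e Φ) b (τ, e x) := rfl

lemma sum_smul_dirz (ξ : Fin n → ℂ) : ∑ α, ξ α • dirz α = ((0, ξ) : ℂ × (Fin n → ℂ)) := by
  ext1
  · simp [dirz, Prod.fst_sum]
  · simp only [dirz, Prod.snd_sum, Prod.smul_snd, sum_smul_single]

lemma hermForm_toBlocks₂₂_coordForm (f : ℂ × (Fin n → ℂ) → ℝ) (b : Matrix (Fin n) (Fin n) ℂ)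
    (q : ℂ × (Fin n → ℂ)) (ξ : Fin n → ℂ) :
    hermForm (coordForm f b q).toBlocks₂₂ ξ =
      (mixedDeriv f q (0, ξ) (0, ξ)).re + hermForm b ξ := by
  rw [coordForm, toBlocks_fromBlocks₂₂, hermForm_add, hermForm_of_mixedDeriv, sum_smul_dirz]

lemma lineForm_coordForm {f : ℂ × (Fin n → ℂ) → ℝ} {b : Matrix (Fin n) (Fin n) ℂ}
    {q : ℂ × (Fin n → ℂ)} (hf : ContDiffAt ℝ 2 f q) (ξ : Fin n → ℂ) :
    lineForm (coordForm f b q) ξ = (mixedDeriv f q (1, ξ) (1, ξ)).re + hermForm b ξ := by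
  have h0 : ((1, ξ) : ℂ × (Fin n → ℂ)) = dirτ n + (0, ξ) := by simp [dirτ]
  have h1 : (ξ ⬝ᵥ fun α => mixedDeriv f q (dirz α) (dirτ n)) =
      mixedDeriv f q (0, ξ) (dirτ n) := by
    rw [← sum_smul_dirz, mixedDeriv_sum_left]; rfl
  have h2 : (mixedDeriv f q (dirτ n) (0, ξ)).re = (mixedDeriv f q (0, ξ) (dirτ n)).re := by
    rw [← mixedDeriv_conj hf]; simp
  rw [lineForm, hermForm_toBlocks₂₂_coordForm]
  simp only [coordForm, fromBlocks_apply₁₁, fromBlocks_apply₂₁, of_apply, h1]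
  rw [h0, mixedDeriv_add_left, mixedDeriv_add_right, mixedDeriv_add_right, Complex.add_re,
    Complex.add_re, Complex.add_re, h2]
  ring

end CoefficientMatrices

/-! ### Second derivatives and Laplacians as limits of difference quotients. -/

section SecondDifferences

/-- The symmetric second difference quotients of `f` at `0` converge to `L`. -/
def HasSecondDiff (f : ℝ → ℝ) (L : ℝ) : Prop :=
  Tendsto (fun r => (f r + f (-r) - 2 * f 0) / r ^ 2) (𝓝[≠] 0) (𝓝 L)

/-- The four point second difference quotients of `f` at `0` converge to `L`; for a function of
class `C²`, `L` is the Laplacian at `0`. -/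
def HasLaplacian (f : ℂ → ℝ) (L : ℝ) : Prop :=
  Tendsto (fun r : ℝ => (f r + f (-r) + f (r * Complex.I) + f (-(r * Complex.I)) - 4 * f 0) / r ^ 2)
    (𝓝[≠] 0) (𝓝 L)

namespace HasSecondDiff

variable {f g : ℝ → ℝ} {L M : ℝ}

lemma unique (hf : HasSecondDiff f L) (hg : HasSecondDiff f M) : L = M :=
  tendsto_nhds_unique hf hg

lemma add (hf : HasSecondDiff f L) (hg : HasSecondDiff g M) :
    HasSecondDiff (fun r => f r + g r) (L + M) := by
  refine (Tendsto.add hf hg).congr fun r => ?_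
  ring

lemma const_mul (c : ℝ) (hf : HasSecondDiff f L) : HasSecondDiff (fun r => c * f r) (c * L) := by
  refine (Tendsto.const_mul c hf).congr fun r => ?_
  ring

lemma sum {ι : Type*} (s : Finset ι) {f : ι → ℝ → ℝ} {L : ι → ℝ}
    (h : ∀ i ∈ s, HasSecondDiff (f i) (L i)) :
    HasSecondDiff (fun r => ∑ i ∈ s, f i r) (∑ i ∈ s, L i) := by
  refine (tendsto_finsetSum s h).congr fun r => ?_
  rw [← Finset.sum_div, Finset.sum_sub_distrib, Finset.sum_add_distrib, ← Finset.mul_sum]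

lemma congr (hf : HasSecondDiff f L) (h : f =ᶠ[𝓝 0] g) : HasSecondDiff g L := by
  have h' : ∀ᶠ r in 𝓝 (0 : ℝ), f (-r) = g (-r) := by
    have : Tendsto (fun r : ℝ => -r) (𝓝 0) (𝓝 0) := by
      simpa using (continuous_neg (G := ℝ)).tendsto 0
    exact this.eventually h
  refine Tendsto.congr' ?_ hf
  filter_upwards [h.filter_mono nhdsWithin_le_nhds, h'.filter_mono nhdsWithin_le_nhds] with r h1 h2
  rw [h1, h2, h.self_of_nhds]

end HasSecondDiff

namespace HasLaplacian

variable {f g : ℂ → ℝ} {L M : ℝ}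

lemma add (hf : HasLaplacian f L) (hg : HasLaplacian g M) :
    HasLaplacian (fun r => f r + g r) (L + M) := by
  refine (Tendsto.add hf hg).congr fun r => ?_
  ring

lemma const_mul (c : ℝ) (hf : HasLaplacian f L) : HasLaplacian (fun r => c * f r) (c * L) := by
  refine (Tendsto.const_mul c hf).congr fun r => ?_
  ring

lemma of_secondDiff (h₁ : HasSecondDiff (fun r => f r) L)
    (h₂ : HasSecondDiff (fun r => f (r * Complex.I)) M) : HasLaplacian f (L + M) := by
  refine (Tendsto.add h₁ h₂).congr fun r => ?_
  push_cast
  rw [neg_mul, zero_mul]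
  ring

lemma nonneg_of_isLocalMin (hf : HasLaplacian f L) (h : ∀ᶠ s in 𝓝 (0 : ℂ), f 0 ≤ f s) :
    0 ≤ L := by
  refine ge_of_tendsto hf (Eventually.filter_mono nhdsWithin_le_nhds ?_)
  have key : ∀ c : ℂ, ∀ᶠ r : ℝ in 𝓝 0, f 0 ≤ f (r * c) := by
    intro c
    have : Tendsto (fun r : ℝ => (r : ℂ) * c) (𝓝 0) (𝓝 0) := by
      have h1 : Continuous fun r : ℝ => (r : ℂ) * c := by fun_prop
      simpa using h1.tendsto 0
    exact this.eventually h
  filter_upwards [key 1, key (-1), key Complex.I, key (-Complex.I)] with r h1 h2 h3 h4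
  rw [mul_one] at h1
  rw [mul_neg_one] at h2
  rw [mul_neg] at h4
  apply div_nonneg _ (sq_nonneg _)
  linarith

end HasLaplacian

lemma ContDiffAt.hasSecondDiff {f : ℝ → ℝ} (hf : ContDiffAt ℝ 2 f 0) :
    HasSecondDiff f (deriv (deriv f) 0) := by
  have h1 : ∀ᶠ r in 𝓝 (0 : ℝ), DifferentiableAt ℝ f r := by
    filter_upwards [hf.eventually (by simp)] with r hr using hr.differentiableAt (by simp)
  have hneg : Tendsto (fun r : ℝ => -r) (𝓝 0) (𝓝 0) := by
    simpa using (continuous_neg (G := ℝ)).tendsto 0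
  have h2 := hneg.eventually h1
  have hd : HasDerivAt (deriv f) (deriv (deriv f) 0) 0 := by
    have : ContDiffAt ℝ 1 (deriv f) 0 := by
      have h := (hf.fderiv_right (m := 1) (by norm_num)).clm_apply
        (contDiffAt_const (c := (1 : ℝ)))
      exact h
    exact (this.differentiableAt (by simp)).hasDerivAt
  -- One use of l'Hôpital reduces to `(f'(r) - f'(-r)) / (2r)`, whose limit needs only
  -- differentiability of `f'` at `0`.
  refine HasDerivAt.lhopital_zero_nhdsNE (f' := fun r => deriv f r - deriv f (-r))
    (g' := fun r => 2 * r) ?_ ?_ ?_ ?_ ?_ ?_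
  · refine Eventually.filter_mono nhdsWithin_le_nhds ?_
    filter_upwards [h1, h2] with r hr1 hr2
    have h3 : HasDerivAt (fun r => f (-r)) (-deriv f (-r)) r := by
      have := hr2.hasDerivAt.comp r (hasDerivAt_neg r)
      rwa [mul_neg_one] at this
    exact ((hr1.hasDerivAt.add h3).sub_const _).congr_deriv (by ring)
  · exact Eventually.of_forall fun r => by simpa using hasDerivAt_pow 2 r
  · filter_upwards [self_mem_nhdsWithin] with r hr
    simpa using hr
  · have hc : ContinuousAt f 0 := hf.continuousAt
    have hc' : Tendsto (fun r => f (-r)) (𝓝 0) (𝓝 (f 0)) := hc.tendsto.comp hneg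
    refine Tendsto.mono_left ?_ nhdsWithin_le_nhds
    have := (hc.tendsto.add hc').sub_const (2 * f 0)
    convert this using 2
    ring
  · refine Tendsto.mono_left ?_ nhdsWithin_le_nhds
    simpa using (continuous_pow (M := ℝ) 2).tendsto 0
  · have hs := hasDerivAt_iff_tendsto_slope_zero.1 hd
    have hneg' : Tendsto (fun r : ℝ => -r) (𝓝[≠] 0) (𝓝[≠] 0) := by
      refine tendsto_nhdsWithin_iff.2 ⟨hneg.mono_left nhdsWithin_le_nhds, ?_⟩
      filter_upwards [self_mem_nhdsWithin] with r hr
      simpa using hr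
    have hs' := hs.comp hneg'
    have := (hs.add hs').const_mul (1 / 2)
    refine Tendsto.congr' ?_ (this.trans_eq ?_)
    · filter_upwards [self_mem_nhdsWithin] with r hr
      have hr : r ≠ 0 := hr
      simp only [Function.comp_apply, smul_eq_mul, zero_add]
      field_simp
      ring
    · congr 1; ring

end SecondDifferences

/-! ### Second derivatives along lines and exchange of the order of differentiation. -/

section Lines

variable {X : Type*} [NormedAddCommGroup X] [NormedSpace ℝ X] {f : X → ℝ} {p : X}

lemma ContDiffAt.fderiv_apply_const {m k : ℕ∞ω} (hf : ContDiffAt ℝ k f p) (h : m + 1 ≤ k) (u : X) :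
    ContDiffAt ℝ m (fun x => fderiv ℝ f x u) p :=
  (hf.fderiv_right h).clm_apply contDiffAt_const

lemma realHess_eq_fderiv_fderiv (hf : ContDiffAt ℝ 2 f p) (u v : X) :
    realHess f p u v = fderiv ℝ (fun x => fderiv ℝ f x v) p u := by
  have h : DifferentiableAt ℝ (fderiv ℝ f) p :=
    (hf.fderiv_right (m := 1) (by norm_num)).differentiableAt (by simp)
  rw [realHess, fderiv_clm_apply h (differentiableAt_const v)]
  simp

lemma ContDiffAt.realHess_apply {m k : ℕ∞ω} (hf : ContDiffAt ℝ k f p) (h : m + 2 ≤ k) (u v : X) :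
    ContDiffAt ℝ m (fun x => realHess f x u v) p := by
  have h1 : ContDiffAt ℝ (m + 1) (fderiv ℝ f) p := hf.fderiv_right (by rwa [add_assoc, one_add_one_eq_two])
  exact ((h1.fderiv_right le_rfl).clm_apply contDiffAt_const).clm_apply contDiffAt_const

/-- Together with uniqueness of the limit, this turns each later change of variables into an
identity between functions on a line, without a second-order chain rule. -/
lemma hasSecondDiff_line (hf : ContDiffAt ℝ 2 f p) (u : X) :
    HasSecondDiff (fun r : ℝ => f (p + r • u)) (realHess f p u u) := by
  have hl : Tendsto (fun r : ℝ => p + r • u) (𝓝 0) (𝓝 p) := by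
    have : Continuous fun r : ℝ => p + r • u := by fun_prop
    simpa using this.tendsto 0
  have hline : ∀ r : ℝ, HasDerivAt (fun r : ℝ => p + r • u) u r := fun r => by
    simpa using ((hasDerivAt_id r).smul_const u).const_add p
  have hcd : ContDiffAt ℝ 2 (fun r : ℝ => f (p + r • u)) 0 := by
    have h0 : ContDiffAt ℝ 2 f (p + (0 : ℝ) • u) := by simpa using hf
    exact h0.comp (0 : ℝ) (f := fun r : ℝ => p + r • u) (by fun_prop)
  have h1 : deriv (fun r : ℝ => f (p + r • u)) =ᶠ[𝓝 0] fun r => fderiv ℝ f (p + r • u) u := by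
    filter_upwards [hl.eventually (hf.eventually (by simp))] with r hr
    exact ((hr.differentiableAt (by simp)).hasFDerivAt.comp_hasDerivAt r (hline r)).deriv
  have h2 : deriv (fun r : ℝ => fderiv ℝ f (p + r • u) u) 0 = realHess f p u u := by
    rw [realHess_eq_fderiv_fderiv hf]
    have h3 : DifferentiableAt ℝ (fun x => fderiv ℝ f x u) (p + (0 : ℝ) • u) := by
      rw [zero_smul, add_zero]
      exact (hf.fderiv_apply_const (m := 1) (by norm_num) u).differentiableAt (by simp)
    have := (h3.hasFDerivAt.comp_hasDerivAt (0 : ℝ) (hline 0)).deriv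
    rw [zero_smul, add_zero] at this
    exact this
  rw [← h2, ← h1.deriv_eq]
  exact hcd.hasSecondDiff

lemma fderiv_fderiv_comm (hf : ContDiffAt ℝ 2 f p) (u v : X) :
    fderiv ℝ (fun x => fderiv ℝ f x v) p u = fderiv ℝ (fun x => fderiv ℝ f x u) p v := by
  rw [← realHess_eq_fderiv_fderiv hf, ← realHess_eq_fderiv_fderiv hf]
  exact hf.isSymmSndFDerivAt (by simp) u v

lemma realHess_realHess_comm (hf : ContDiffAt ℝ 4 f p) (u v : X) :
    realHess (fun x => realHess f x u u) p v v = realHess (fun x => realHess f x v v) p u u := by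
  have ev : ∀ {k : ℕ} {g : X → ℝ}, ContDiffAt ℝ k g p → ∀ᶠ x in 𝓝 p, ContDiffAt ℝ k g x :=
    fun h => h.eventually (by simp)
  have key : ∀ (g : X → ℝ), ContDiffAt ℝ 3 g p → ∀ u v : X,
      fderiv ℝ (fun x => fderiv ℝ (fun x => fderiv ℝ g x u) x u) p v =
        fderiv ℝ (fun x => fderiv ℝ (fun x => fderiv ℝ g x v) x u) p u := by
    intro g hg u v
    rw [fderiv_fderiv_comm (hg.fderiv_apply_const (m := 2) (by norm_num) u)]
    congr 1
    apply Filter.EventuallyEq.fderiv_eq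
    filter_upwards [ev (k := 3) hg] with x hx
    exact fderiv_fderiv_comm (hx.of_le (by norm_num)) _ _
  have step : ∀ u v : X, realHess (fun x => realHess f x u u) p v v =
      fderiv ℝ (fun x => fderiv ℝ (fun x => fderiv ℝ (fun x => fderiv ℝ f x u) x u) x v) p v := by
    intro u v
    have e1 : (fun x => realHess f x u u) =ᶠ[𝓝 p]
        fun x => fderiv ℝ (fun x => fderiv ℝ f x u) x u := by
      filter_upwards [ev (k := 4) hf] with x hx
      exact realHess_eq_fderiv_fderiv (hx.of_le (by norm_num)) _ _
    have hc : ContDiffAt ℝ 2 (fun x => realHess f x u u) p := hf.realHess_apply (by norm_num) u u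
    rw [realHess_eq_fderiv_fderiv hc]
    congr 1
    apply Filter.EventuallyEq.fderiv_eq
    filter_upwards [e1.eventuallyEq_nhds] with x hx
    rw [hx.fderiv_eq]
  rw [step, step]
  have e2 : (fun x => fderiv ℝ (fun x => fderiv ℝ (fun x => fderiv ℝ f x u) x u) x v) =ᶠ[𝓝 p]
      fun x => fderiv ℝ (fun x => fderiv ℝ (fun x => fderiv ℝ f x v) x u) x u := by
    filter_upwards [ev (k := 4) hf] with x hx
    have hg : ContDiffAt ℝ 3 f x := hx.of_le (by norm_num)
    rw [fderiv_fderiv_comm (hg.fderiv_apply_const (m := 2) (by norm_num) u)]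
    congr 1
    apply Filter.EventuallyEq.fderiv_eq
    filter_upwards [hg.eventually (by simp)] with y hy
    exact fderiv_fderiv_comm (hy.of_le (by norm_num)) _ _
  rw [e2.fderiv_eq, key _ (hf.fderiv_apply_const (m := 3) (by norm_num) v) u v]

/-- Differentiating twice in `t` and twice in `r` the function `f (p + t ξ + r Y + t r ζ)` of two
real variables, in either order. -/
lemma exists_hasSecondDiff_realHess (hf : ContDiffAt ℝ 4 f p) (ξ Y ζ : X) :
    ∃ L, HasSecondDiff (fun r : ℝ => realHess f (p + r • Y) (ξ + r • ζ) (ξ + r • ζ)) L ∧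
      HasSecondDiff (fun t : ℝ => realHess f (p + t • ξ) (Y + t • ζ) (Y + t • ζ)) L := by
  set u : ℝ × ℝ → ℝ := fun q => f (p + q.1 • ξ + q.2 • Y + (q.1 * q.2) • ζ) with hu
  have hu4 : ContDiffAt ℝ 4 u 0 := by
    have h0 : ContDiffAt ℝ 4 f (p + (0 : ℝ × ℝ).1 • ξ + (0 : ℝ × ℝ).2 • Y +
        ((0 : ℝ × ℝ).1 * (0 : ℝ × ℝ).2) • ζ) := by simpa using hf
    exact h0.comp (0 : ℝ × ℝ)
      (f := fun q : ℝ × ℝ => p + q.1 • ξ + q.2 • Y + (q.1 * q.2) • ζ) (by fun_prop)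
  have hu' : ∀ᶠ q in 𝓝 (0 : ℝ × ℝ), ContDiffAt ℝ 4 u q := hu4.eventually (by simp)
  have hf' : ∀ᶠ x in 𝓝 p, ContDiffAt ℝ 4 f x := hf.eventually (by simp)
  have hD : ∀ w : ℝ × ℝ, ContDiffAt ℝ 2 (fun q => realHess u q w w) 0 := fun w =>
    hu4.realHess_apply (by norm_num) w w
  have hlin : ∀ w : ℝ × ℝ, Tendsto (fun r : ℝ => r • w) (𝓝 0) (𝓝 0) := fun w => by
    have : Continuous fun r : ℝ => r • w := by fun_prop
    simpa using this.tendsto 0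
  have hlin' : ∀ w : X, Tendsto (fun r : ℝ => p + r • w) (𝓝 0) (𝓝 p) := fun w => by
    have : Continuous fun r : ℝ => p + r • w := by fun_prop
    simpa using this.tendsto 0
  -- The common value is the fourth derivative `∂_r² ∂_t² u` at the origin. The cross term `t r ζ`
  -- makes the `t`-velocity at `t = 0` equal to `ξ + rζ`, and the `r`-velocity at `r = 0` equal to
  -- `Y + tζ`.
  refine ⟨realHess (fun q => realHess u q (1, 0) (1, 0)) 0 (0, 1) (0, 1), ?_, ?_⟩
  · refine (hasSecondDiff_line (hD (1, 0)) (0, 1)).congr ?_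
    filter_upwards [(hlin (0, 1)).eventually hu', (hlin' Y).eventually hf'] with r h1 h2
    have s1 := hasSecondDiff_line (h1.of_le (by norm_num)) ((1, 0) : ℝ × ℝ)
    have s2 := hasSecondDiff_line (h2.of_le (by norm_num)) (ξ + r • ζ)
    rw [zero_add]
    refine s1.unique (s2.congr (Eventually.of_forall fun t => ?_))
    simp only [hu]
    congr 1
    simp only [Prod.smul_mk, Prod.mk_add_mk, smul_eq_mul, mul_zero, mul_one, zero_add, add_zero,
      smul_add, smul_smul]
    abel
  · rw [realHess_realHess_comm hu4]
    refine (hasSecondDiff_line (hD (0, 1)) (1, 0)).congr ?_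
    filter_upwards [(hlin (1, 0)).eventually hu', (hlin' ξ).eventually hf'] with r h1 h2
    have s1 := hasSecondDiff_line (h1.of_le (by norm_num)) ((0, 1) : ℝ × ℝ)
    have s2 := hasSecondDiff_line (h2.of_le (by norm_num)) (Y + r • ζ)
    rw [zero_add]
    refine s1.unique (s2.congr (Eventually.of_forall fun t => ?_))
    simp only [hu]
    congr 1
    simp only [Prod.smul_mk, Prod.mk_add_mk, smul_eq_mul, mul_zero, mul_one, zero_add, add_zero,
      smul_add, smul_smul, mul_comm]
    abel

end Lines

/-! ### The Laplacian along a complex line. -/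

section ComplexLines

variable {X : Type*} [NormedAddCommGroup X] [NormedSpace ℝ X] [NormedSpace ℂ X]
  [IsScalarTower ℝ ℂ X] {f : X → ℝ} {p : X}

lemma hasLaplacian_line (hf : ContDiffAt ℝ 2 f p) (u : X) :
    HasLaplacian (fun s : ℂ => f (p + s • u)) (4 * (mixedDeriv f p u u).re) := by
  have h1 := hasSecondDiff_line hf u
  have h2 := hasSecondDiff_line hf (Complex.I • u)
  have e : 4 * (mixedDeriv f p u u).re =
      realHess f p u u + realHess f p (Complex.I • u) (Complex.I • u) := by
    rw [mixedDeriv_self_re]; ring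
  rw [e]
  refine HasLaplacian.of_secondDiff (h1.congr (Eventually.of_forall fun r => ?_))
    (h2.congr (Eventually.of_forall fun r => ?_))
  · beta_reduce
    rw [← algebraMap_smul ℂ r u]; rfl
  · beta_reduce
    rw [← algebraMap_smul ℂ r (Complex.I • u), smul_smul]; rfl

end ComplexLines

/-! ### Second derivatives of the constant-coefficient terms. -/

section Quadratic

variable {n : ℕ}

/-- The pairings of `w₀` with `s w₁` and `s² w₂` are harmonic, and the remaining terms with `w₂` do
not affect the Laplacian at `0`. The `s²` term is there to accommodate the product `(τ + sa)(ξ +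
sζ)` in the barrier. -/
lemma hasLaplacian_hermForm {b : Matrix (Fin n) (Fin n) ℂ} (hb : b.IsHermitian)
    (w₀ w₁ w₂ : Fin n → ℂ) :
    HasLaplacian (fun s => hermForm b (w₀ + s • w₁ + s ^ 2 • w₂)) (4 * hermForm b w₁) := by
  have h : Tendsto (fun r : ℝ => 4 * hermForm b w₁ + 4 * r ^ 2 * hermForm b w₂) (𝓝[≠] 0)
      (𝓝 (4 * hermForm b w₁)) := by
    have : Continuous fun r : ℝ => 4 * hermForm b w₁ + 4 * r ^ 2 * hermForm b w₂ := by fun_prop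
    simpa using (this.tendsto 0).mono_left nhdsWithin_le_nhds
  refine h.congr' ?_
  filter_upwards [self_mem_nhdsWithin] with r hr
  have hr : r ≠ 0 := hr
  rw [eq_div_iff (by positivity)]
  simp only [hermForm_add_vec hb, hermForm_smul, star_smul, mulVec_smul, dotProduct_smul,
    smul_dotProduct, star_add, mulVec_add, dotProduct_add, smul_eq_mul]
  simp [pow_two]
  ring

/-- The real part of a holomorphic polynomial is harmonic. This is why the constant tensor `T`
contributes nothing to the maximum principle when `ξ` varies holomorphically. -/
lemma hasLaplacian_symmForm {T : Matrix (Fin n) (Fin n) ℂ} (w₀ w₁ : Fin n → ℂ) :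
    HasLaplacian (fun s => symmForm T (w₀ + s • w₁)) 0 := by
  refine tendsto_const_nhds.congr fun r => ?_
  simp only [symmForm, mulVec_add, dotProduct_add, add_dotProduct, mulVec_smul, dotProduct_smul,
    smul_dotProduct, smul_eq_mul]
  simp
  ring

lemma hasSecondDiff_hermForm {b : Matrix (Fin n) (Fin n) ℂ} (hb : b.IsHermitian)
    (w₀ w₁ : Fin n → ℂ) :
    HasSecondDiff (fun t : ℝ => hermForm b (w₀ + (t : ℂ) • w₁)) (2 * hermForm b w₁) := by
  refine (tendsto_const_nhds (x := 2 * hermForm b w₁)).congr' ?_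
  filter_upwards [self_mem_nhdsWithin] with r hr
  have hr : r ≠ 0 := hr
  rw [eq_div_iff (by positivity)]
  simp only [hermForm_add_vec hb, hermForm_smul, smul_dotProduct, smul_eq_mul]
  simp
  ring

lemma hasSecondDiff_dotProduct (c w₀ w₁ : Fin n → ℂ) :
    HasSecondDiff (fun t : ℝ => ((w₀ + (t : ℂ) • w₁) ⬝ᵥ c).re) 0 := by
  refine tendsto_const_nhds.congr fun r => ?_
  simp only [add_dotProduct, smul_dotProduct, smul_eq_mul]
  simp
  ring

end Quadratic

/-! ### The maximum principle for the convexity form. -/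

section InteriorMinimum

variable {n : ℕ}

/-- A residual that vanishes to first order is `o(t)`, so its square is `o(t²)`. The derivative of
`g⁻¹` is never needed, only its continuity. -/
lemma tendsto_hermForm_inv_div_sq {g : ℝ → Matrix (Fin n) (Fin n) ℂ} (hg : ContinuousAt g 0)
    (h0 : (g 0).PosDef) {R : ℝ → Fin n → ℂ} (hR : HasDerivAt R 0 0) (hR0 : R 0 = 0) :
    Tendsto (fun t => hermForm (g t)⁻¹ (star (R t)) / t ^ 2) (𝓝[≠] 0) (𝓝 0) := by
  have hdet : (g 0).det ≠ 0 := ((isUnit_iff_isUnit_det _).1 h0.isUnit).ne_zero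
  have hinv : ContinuousAt (fun t => (g t)⁻¹) 0 := by
    refine (continuousAt_matrix_inv (g 0) ?_).comp hg
    rw [Ring.inverse_eq_inv']
    exact continuousAt_inv₀ hdet
  have hs : Tendsto (fun t : ℝ => t⁻¹ • R t) (𝓝[≠] 0) (𝓝 0) := by
    have := hasDerivAt_iff_tendsto_slope_zero.1 hR
    simpa [hR0] using this
  have hc : Continuous fun q : Matrix (Fin n) (Fin n) ℂ × (Fin n → ℂ) =>
      hermForm q.1 (star q.2) := by
    simp only [hermForm_star]
    have : Continuous fun q : Matrix (Fin n) (Fin n) ℂ × (Fin n → ℂ) => q.1 *ᵥ q.2 :=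
      continuous_fst.matrix_mulVec continuous_snd
    exact Complex.continuous_re.comp ((continuous_snd.star).dotProduct this)
  have hlim := (hc.tendsto ((g 0)⁻¹, 0)).comp
    ((hinv.tendsto.mono_left nhdsWithin_le_nhds).prodMk_nhds hs)
  have hz : hermForm (g 0)⁻¹ (star (0 : Fin n → ℂ)) = 0 := by simp [hermForm]
  rw [hz] at hlim
  refine hlim.congr fun t => ?_
  have : star (t⁻¹ • R t) = ((t⁻¹ : ℝ) : ℂ) • star (R t) := by
    ext i; simp
  simp only [Function.comp_apply]
  rw [this, hermForm_smul]
  simp [div_eq_inv_mul]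

/-- The derivative at `0` of `t ↦ g(t) (V + t ζ)‾ + c(t)`. -/
lemma hasDerivAt_residual {g : ℝ → Matrix (Fin n) (Fin n) ℂ} {g' : Matrix (Fin n) (Fin n) ℂ}
    {c : ℝ → Fin n → ℂ} {c' : Fin n → ℂ} (hg : ∀ α β, HasDerivAt (fun t => g t α β) (g' α β) 0)
    (hc : HasDerivAt c c' 0) (V ζ : Fin n → ℂ) :
    HasDerivAt (fun t : ℝ => g t *ᵥ star (V + (t : ℂ) • ζ) + c t)
      (g' *ᵥ star V + g 0 *ᵥ star ζ + c') 0 := by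
  refine HasDerivAt.add (hasDerivAt_pi.2 fun α => ?_) hc
  have h1 : ∀ β, HasDerivAt (fun t : ℝ => star V β + (t : ℂ) * star ζ β) (star ζ β) 0 := by
    intro β
    have := ((Complex.ofRealCLM.hasDerivAt (x := (0 : ℝ))).mul_const (star ζ β)).const_add (star V β)
    simpa using this
  have h2 := HasDerivAt.fun_sum (u := Finset.univ) fun β _ => (hg α β).mul (h1 β)
  refine (h2.congr_deriv ?_).congr_of_eventuallyEq (Eventually.of_forall fun t => ?_)
  · simp [mulVec, dotProduct, Finset.sum_add_distrib]
  · simp [mulVec, dotProduct, mul_add]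

/-- The form whose positivity is propagated from the boundary to the interior: the Hessian in the
directions of `V`, corrected by constant multiples of `ω₀` and of the real part of `T` and by a
small barrier. -/
def convexityForm (f : ℂ × (Fin n → ℂ) → ℝ) (b T : Matrix (Fin n) (Fin n) ℂ) (β κ : ℝ)
    (q : ℂ × (Fin n → ℂ)) (ξ : Fin n → ℂ) : ℝ :=
  1 / 2 * realHess f q (0, ξ) (0, ξ) + (1 - β) * hermForm b ξ + symmForm T ξ
    - κ * ((1 + ‖q.1‖ ^ 2) * hermForm b ξ)

variable {f : ℂ × (Fin n → ℂ) → ℝ} {p : ℂ × (Fin n → ℂ)} {b T : Matrix (Fin n) (Fin n) ℂ}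

lemma real_smul_vec (t : ℝ) (V : Fin n → ℂ) : t • V = (t : ℂ) • V := rfl

/-- Along a complex line with direction `(a, V)`, with `ξ` varying holomorphically, the Laplacian
of the convexity form is the second derivative along `ξ` of the complex Hessian in the direction
`(a, V)`, up to nonpositive terms. -/
lemma exists_hasLaplacian_convexityForm (hf : ContDiffAt ℝ 4 f p) (hb : b.IsHermitian) (β κ : ℝ)
    (ξ V ζ : Fin n → ℂ) (a : ℂ) :
    ∃ L, HasSecondDiff (fun t : ℝ => (mixedDeriv f (p + t • ((0, ξ) : ℂ × (Fin n → ℂ)))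
        (a, V + (t : ℂ) • ζ) (a, V + (t : ℂ) • ζ)).re + hermForm b (V + (t : ℂ) • ζ)) L ∧
      HasLaplacian (fun s => convexityForm f b T β κ (p + s • (a, V)) (ξ + s • ζ))
        (2 * L - 4 * (β + κ) * hermForm b ζ - 4 * κ * hermForm b (a • ξ + p.1 • ζ)) := by
  obtain ⟨L₁, hA₁, hB₁⟩ := exists_hasSecondDiff_realHess hf (0, ξ) (a, V) (0, ζ)
  obtain ⟨L₂, hA₂, hB₂⟩ := exists_hasSecondDiff_realHess hf (0, ξ)
    (Complex.I • (a, V)) (Complex.I • (0, ζ))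
  refine ⟨1 / 4 * (L₁ + L₂) + 2 * hermForm b ζ, ?_, ?_⟩
  · refine (((hB₁.add hB₂).const_mul (1 / 4)).add (hasSecondDiff_hermForm hb V ζ)).congr
      (Eventually.of_forall fun t => ?_)
    simp only [mixedDeriv_self_re, Prod.smul_mk, Prod.mk_add_mk, add_zero, smul_zero, smul_add,
      real_smul_vec, smul_comm Complex.I (t : ℂ) ζ]
  · have h1 : HasLaplacian (fun s : ℂ => realHess f (p + s • (a, V)) (0, ξ + s • ζ) (0, ξ + s • ζ))
        (L₁ + L₂) := by
      refine HasLaplacian.of_secondDiff (hA₁.congr (Eventually.of_forall fun r => ?_))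
        (hA₂.congr (Eventually.of_forall fun r => ?_))
      · simp only [Prod.smul_mk, Prod.mk_add_mk, smul_zero, real_smul_vec, add_zero,
          Complex.real_smul, smul_eq_mul]
      · simp only [Prod.smul_mk, Prod.mk_add_mk, zero_add, real_smul_vec, mul_zero,
          Complex.real_smul, smul_eq_mul, smul_smul, mul_assoc]
    have h2 : HasLaplacian (fun s => hermForm b (ξ + s • ζ)) (4 * hermForm b ζ) := by
      simpa using hasLaplacian_hermForm hb ξ ζ 0
    have h3 := hasLaplacian_hermForm hb (p.1 • ξ) (a • ξ + p.1 • ζ) (a • ζ)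
    have h4 := hasLaplacian_symmForm (T := T) ξ ζ
    have h5 := ((((h1.const_mul (1 / 2)).add (h2.const_mul (1 - β))).add h4).add
      ((h2.add h3).const_mul (-κ)))
    refine Eq.mp ?_ h5
    congr 1
    · funext s
      -- The part `|τ|² ω₀(ξ,ξ̄)` of the barrier is `ω₀` evaluated on `τξ`, which is holomorphic
      -- along the line, so its Laplacian is a nonnegative form.
      have e : p.1 • ξ + s • (a • ξ + p.1 • ζ) + s ^ 2 • a • ζ = (p.1 + s * a) • (ξ + s • ζ) := by
        ext i
        simp only [Pi.add_apply, Pi.smul_apply, smul_eq_mul]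
        ring
      rw [e, hermForm_smul, convexityForm]
      simp only [Prod.fst_add, Prod.smul_mk, smul_eq_mul]
      ring
    · ring

/-- The convexity form of a solution cannot touch zero at an interior point. -/
theorem convexityForm_pos_of_nonneg (hf : ContDiffAt ℝ 4 f p) (hb : b.PosDef) {β κ ε : ℝ}
    (hβ : 0 ≤ β) (hκ : 0 < κ) (hε : 0 < ε)
    (hM : ∀ᶠ q in 𝓝 p, (coordForm f b q).PosDef ∧ PerturbedEquation b ε (coordForm f b q))
    (hQ : ∀ᶠ q in 𝓝 p, ∀ ξ, 0 ≤ convexityForm f b T β κ q ξ) {ξ : Fin n → ℂ} (hξ : ξ ≠ 0) :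
    0 < convexityForm f b T β κ p ξ := by
  refine lt_of_le_of_ne (hQ.self_of_nhds ξ) fun hzero => ?_
  obtain ⟨C, hC⟩ := exists_eq_mul_conjTranspose hb
  have hbH := hb.isHermitian
  set l : ℝ → ℂ × (Fin n → ℂ) := fun t => p + t • (0, ξ) with hl
  have hl0 : l 0 = p := by simp [hl]
  have hlc : Tendsto l (𝓝 0) (𝓝 p) := by
    have : Continuous l := by fun_prop
    simpa [hl0] using this.tendsto 0
  have hld : HasDerivAt l ((0, ξ) : ℂ × (Fin n → ℂ)) 0 := by
    have := ((hasDerivAt_id (0 : ℝ)).smul_const ((0, ξ) : ℂ × (Fin n → ℂ))).const_add p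
    rwa [one_smul] at this
  have hdiff : ∀ u v, ∃ d : ℂ, HasDerivAt (fun t => mixedDeriv f (l t) u v) d 0 := by
    intro u v
    have h1 : ∀ u v, DifferentiableAt ℝ (fun x => realHess f x u v) (l 0) := by
      intro u v
      rw [hl0]
      exact (hf.realHess_apply (m := 1) (by norm_num) u v).differentiableAt (by simp)
    have h2 : ∀ u v, DifferentiableAt ℝ (fun t => realHess f (l t) u v) 0 := fun u v =>
      (h1 u v).comp (0 : ℝ) hld.differentiableAt
    have h3 : ∀ u v u' v', ∀ c : ℝ,
        DifferentiableAt ℝ (fun t => ((realHess f (l t) u v + c * realHess f (l t) u' v' : ℝ) : ℂ)) 0 :=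
      fun u v u' v' c => Complex.ofRealCLM.differentiableAt.comp (0 : ℝ)
        ((h2 u v).add ((h2 u' v').const_mul c))
    have h4 : DifferentiableAt ℝ (fun t => mixedDeriv f (l t) u v) 0 := by
      have := ((h3 u v (Complex.I • u) (Complex.I • v) 1).add
        ((h3 u (Complex.I • v) (Complex.I • u) v (-1)).const_mul Complex.I)).const_mul (1 / 4 : ℂ)
      refine this.congr_of_eventuallyEq (Eventually.of_forall fun t => ?_)
      simp [mixedDeriv, sub_eq_add_neg]
    exact ⟨_, h4.hasDerivAt⟩
  choose D hD using hdiff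
  set g : ℝ → Matrix (Fin n) (Fin n) ℂ := fun t => (coordForm f b (l t)).toBlocks₂₂ with hg
  set c : ℝ → Fin n → ℂ := fun t α => coordForm f b (l t) (Sum.inr α) (Sum.inl ()) with hc
  set g' : Matrix (Fin n) (Fin n) ℂ := Matrix.of fun α β => D (dirz α) (dirz β) with hg'
  set c' : Fin n → ℂ := fun α => D (dirz α) (dirτ n) with hc'
  have hgd : ∀ α β, HasDerivAt (fun t => g t α β) (g' α β) 0 := fun α β =>
    (hD (dirz α) (dirz β)).add_const (b α β)
  have hcd : HasDerivAt c c' 0 := hasDerivAt_pi.2 fun α => hD (dirz α) (dirτ n)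
  have hgc : ContinuousAt g 0 :=
    continuousAt_pi.2 fun α => continuousAt_pi.2 fun β => (hgd α β).continuousAt
  have hM' := hlc.eventually hM
  have hg0 : (g 0).PosDef := posDef_toBlocks₂₂ hM'.self_of_nhds.1
  have hdet : IsUnit (g 0).det := (isUnit_iff_isUnit_det _).1 hg0.isUnit
  have hsolve : ∀ w : Fin n → ℂ, ∃ V : Fin n → ℂ, g 0 *ᵥ star V = w := fun w =>
    ⟨star ((g 0)⁻¹ *ᵥ w), by
      rw [star_star, mulVec_mulVec, mul_nonsing_inv _ hdet, one_mulVec]⟩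
  -- `V` minimizes the form on `(1, V)` at `p`, and `E k` plays the same role for the `k`-th column
  -- of `C`. The velocities `ζ` and `Z k` solve the linearized equations, so that the residuals have
  -- zero derivative at `t = 0`.
  obtain ⟨V, hV⟩ := hsolve (-c 0)
  obtain ⟨ζ, hζ⟩ := hsolve (-(g' *ᵥ star V + c'))
  choose E hE using fun k => hsolve (Cᵀ k)
  choose Z hZ using fun k => hsolve (-(g' *ᵥ star (E k)))
  -- residuals vanish to first order
  have hR : HasDerivAt (fun t : ℝ => g t *ᵥ star (V + (t : ℂ) • ζ) + c t) 0 0 := by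
    refine (hasDerivAt_residual hgd hcd V ζ).congr_deriv ?_
    rw [hζ]; abel
  have hRk : ∀ k, HasDerivAt (fun t : ℝ => g t *ᵥ star (E k + (t : ℂ) • Z k) + -(Cᵀ k)) 0 0 := by
    intro k
    refine (hasDerivAt_residual hgd (hasDerivAt_const (0 : ℝ) (-(Cᵀ k))) (E k) (Z k)).congr_deriv ?_
    rw [hZ]; abel
  have hR0 : g 0 *ᵥ star (V + ((0 : ℝ) : ℂ) • ζ) + c 0 = 0 := by simp [hV]
  have hRk0 : ∀ k, g 0 *ᵥ star (E k + ((0 : ℝ) : ℂ) • Z k) + -(Cᵀ k) = 0 := by simp [hE]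
  -- The direction `(1, V)` carries the Schur complement, and the vertical directions `(0, E k)`
  -- carry the trace term.
  obtain ⟨L, hL, hLap⟩ := exists_hasLaplacian_convexityForm (T := T) hf hbH β κ ξ V ζ 1
  choose Lk hLk hLapk using fun k =>
    exists_hasLaplacian_convexityForm (T := T) hf hbH β κ ξ (E k) (Z k) 0
  -- the equation differentiated twice
  have hsum : L + ε * ∑ k, Lk k = 0 := by
    -- The added terms `-2 Re (E k + t Z k)·Cᵀ k` are affine in `t`, so they leave the second
    -- derivatives unchanged. They complete the squares whose constant parts cancel the trace on the
    -- right of the equation.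
    have h1 := hL.add ((HasSecondDiff.sum Finset.univ fun k _ => (hLk k).add
      ((hasSecondDiff_dotProduct (Cᵀ k) (E k) (Z k)).const_mul (-2))).const_mul ε)
    simp only [mul_zero, add_zero] at h1
    set m : ℝ → ℝ := fun t => hermForm (g t)⁻¹ (star (g t *ᵥ star (V + (t : ℂ) • ζ) + c t)) +
      ε * ∑ k, hermForm (g t)⁻¹ (star (g t *ᵥ star (E k + (t : ℂ) • Z k) + -(Cᵀ k))) with hm
    have h2 := h1.congr (g := m) (by
      filter_upwards [hM', hlc.eventually (hf.eventually (by simp))] with t ht hft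
      have e1 := lineForm_coordForm (b := b) (hft.of_le (by norm_num : (2 : ℕ∞ω) ≤ 4))
        (V + (t : ℂ) • ζ)
      have e2 := lineForm_eq ht.1 ht.2 (V + (t : ℂ) • ζ)
      have e3 : ∀ k, (mixedDeriv f (l t) (0, E k + (t : ℂ) • Z k) (0, E k + (t : ℂ) • Z k)).re
          + hermForm b (E k + (t : ℂ) • Z k) + -2 * ((E k + (t : ℂ) • Z k) ⬝ᵥ Cᵀ k).re =
          hermForm (g t)⁻¹ (star (g t *ᵥ star (E k + (t : ℂ) • Z k) + -(Cᵀ k)))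
            - hermForm (g t)⁻¹ (star (Cᵀ k)) := by
        intro k
        have hneg : hermForm (g t)⁻¹ (star (-(Cᵀ k))) = hermForm (g t)⁻¹ (star (Cᵀ k)) := by
          simp [hermForm, mulVec_neg]
        rw [hermForm_inv_add (posDef_toBlocks₂₂ ht.1), hneg, dotProduct_neg, Complex.neg_re,
          hermForm_toBlocks₂₂_coordForm]
        ring
      rw [hC, traceInv_eq_sum, ← hC] at e2
      simp only [hm]
      rw [← e1, e2, Finset.sum_congr rfl fun k _ => e3 k, Finset.sum_sub_distrib]
      ring)
    have h3 : HasSecondDiff m 0 := by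
      have ht1 := tendsto_hermForm_inv_div_sq hgc hg0 hR hR0
      have ht2 := (tendsto_finsetSum Finset.univ fun k _ =>
        tendsto_hermForm_inv_div_sq hgc hg0 (hRk k) (hRk0 k)).const_mul ε
      have ht := ht1.add ht2
      simp only [Finset.sum_const_zero, mul_zero, add_zero] at ht
      have hm0 : m 0 = 0 := by
        simp only [hm, hR0, hRk0]
        simp [hermForm]
      have htm : Tendsto (fun t => m t / t ^ 2) (𝓝[≠] 0) (𝓝 0) := by
        refine ht.congr fun t => ?_
        rw [hm, add_div, mul_div_assoc, Finset.sum_div]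
      have hneg' : Tendsto (fun r : ℝ => -r) (𝓝[≠] 0) (𝓝[≠] 0) := by
        refine tendsto_nhdsWithin_iff.2 ⟨?_, ?_⟩
        · have := ((continuous_neg (G := ℝ)).tendsto 0).mono_left (nhdsWithin_le_nhds (s := {0}ᶜ))
          simpa using this
        · filter_upwards [self_mem_nhdsWithin] with r hr
          simpa using hr
      have := htm.add (htm.comp hneg')
      rw [add_zero] at this
      refine this.congr fun t => ?_
      rw [hm0]
      simp only [Function.comp_apply, neg_sq]
      ring
    exact h2.unique h3
  -- the Laplacians at the minimum are nonnegative
  have hnn : ∀ (a : ℂ) (W Y : Fin n → ℂ) (Λ : ℝ),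
      HasLaplacian (fun s => convexityForm f b T β κ (p + s • (a, W)) (ξ + s • Y)) Λ → 0 ≤ Λ := by
    intro a W Y Λ hΛ
    refine hΛ.nonneg_of_isLocalMin ?_
    have : Tendsto (fun s : ℂ => p + s • ((a, W) : ℂ × (Fin n → ℂ))) (𝓝 0) (𝓝 p) := by
      have : Continuous fun s : ℂ => p + s • ((a, W) : ℂ × (Fin n → ℂ)) := by fun_prop
      simpa using this.tendsto 0
    filter_upwards [this.eventually hQ] with s hs
    rw [zero_smul, zero_smul, add_zero, add_zero, ← hzero]
    exact hs _
  have n1 := hnn _ _ _ _ hLap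
  have n2 := Finset.sum_nonneg fun k (_ : k ∈ Finset.univ) => hnn _ _ _ _ (hLapk k)
  have n3 : ∑ k, (2 * Lk k - 4 * (β + κ) * hermForm b (Z k)
      - 4 * κ * hermForm b ((0 : ℂ) • ξ + p.1 • Z k)) ≤ 2 * ∑ k, Lk k := by
    rw [Finset.mul_sum]
    refine Finset.sum_le_sum fun k _ => ?_
    have := mul_nonneg (by positivity : 0 ≤ 4 * (β + κ)) (hermForm_nonneg hb (Z k))
    have := mul_nonneg (by positivity : 0 ≤ 4 * κ)
      (hermForm_nonneg hb ((0 : ℂ) • ξ + p.1 • Z k))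
    linarith
  have n4 := mul_le_mul_of_nonneg_left (n2.trans n3) hε.le
  have hζb := hermForm_nonneg hb ζ
  have hζb' := hermForm_nonneg hb ((1 : ℂ) • ξ + p.1 • ζ)
  -- Adding the Laplacian inequalities with weights `1` and `ε` cancels `L` and the `Lk` by `hsum`.
  -- Only the `β` and barrier terms remain: the constant part of the barrier forces `ζ = 0` even
  -- when `β = 0`, and the `|τ|²` part then contradicts `ξ ≠ 0`.
  have n5 : 4 * (β + κ) * hermForm b ζ + 4 * κ * hermForm b ((1 : ℂ) • ξ + p.1 • ζ) ≤ 0 := by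
    linarith
  have n6 : 0 ≤ β * hermForm b ζ := mul_nonneg hβ hζb
  have n7 : 0 ≤ κ * hermForm b ζ := mul_nonneg hκ.le hζb
  have n8 : 0 ≤ κ * hermForm b ((1 : ℂ) • ξ + p.1 • ζ) := mul_nonneg hκ.le hζb'
  have hζ0 : ζ = 0 := by
    by_contra h
    have := mul_pos hκ (hermForm_pos hb h)
    linarith
  rw [hζ0, one_smul, smul_zero, add_zero] at n5 n8
  have := mul_pos hκ (hermForm_pos hb hξ)
  rw [hζ0] at n6 n7
  linarith

end InteriorMinimum

/-! ### Comparison and uniqueness for the Dirichlet problem. -/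

section Comparison

variable {n : ℕ}

lemma hasLaplacian_normSq (κ : ℝ) (τ a : ℂ) :
    HasLaplacian (fun s => κ * ‖τ + s * a‖ ^ 2) (4 * (κ * ‖a‖ ^ 2)) := by
  refine (tendsto_const_nhds (x := 4 * (κ * ‖a‖ ^ 2))).congr' ?_
  filter_upwards [self_mem_nhdsWithin] with r hr
  have hr : r ≠ 0 := hr
  rw [eq_div_iff (by positivity)]
  simp only [← Complex.normSq_eq_norm_sq, Complex.normSq_apply]
  simp
  ring

/-- At an interior maximum the Laplacian along a complex line is nonpositive. The base points and
the vertical directions of the two functions may differ, which lets one solution be compared with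
itself at two points of `V`. -/
lemma mixedDeriv_sub_le {f₁ f₂ : ℂ × (Fin n → ℂ) → ℝ} {τ : ℂ} {z₁ z₂ : Fin n → ℂ}
    (h₁ : ContDiffAt ℝ 2 f₁ (τ, z₁)) (h₂ : ContDiffAt ℝ 2 f₂ (τ, z₂)) {κ : ℝ} {a : ℂ}
    {W₁ W₂ : Fin n → ℂ}
    (hmax : ∀ᶠ s in 𝓝 (0 : ℂ), f₁ (τ + s * a, z₁ + s • W₁) - f₂ (τ + s * a, z₂ + s • W₂)
      + κ * ‖τ + s * a‖ ^ 2 ≤ f₁ (τ, z₁) - f₂ (τ, z₂) + κ * ‖τ‖ ^ 2) :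
    (mixedDeriv f₁ (τ, z₁) (a, W₁) (a, W₁)).re + κ * ‖a‖ ^ 2 ≤
      (mixedDeriv f₂ (τ, z₂) (a, W₂) (a, W₂)).re := by
  have l1 := (((hasLaplacian_line h₁ (a, W₁)).const_mul (-1)).add
    (hasLaplacian_line h₂ (a, W₂))).add ((hasLaplacian_normSq κ τ a).const_mul (-1))
  have := l1.nonneg_of_isLocalMin (by
    filter_upwards [hmax] with s hs
    simp only [zero_smul, zero_mul, add_zero, Prod.smul_mk, Prod.mk_add_mk, smul_eq_mul]
    linarith)
  linarith

variable {V : Type*} [TopologicalSpace V] [ChartedSpace (Fin n → ℂ) V] {R : Set ℂ}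
  {b : OpenPartialHomeomorph V (Fin n → ℂ) → Matrix (Fin n) (Fin n) ℂ} {ε : ℝ} {F Φ Ψ : ℂ → V → ℝ}

lemma IsSolution.contDiffAt (hΦ : IsSolution R b ε F Φ) (hR : IsOpen R)
    {e : OpenPartialHomeomorph V (Fin n → ℂ)} (he : e ∈ atlas (Fin n → ℂ) V) {τ : ℂ} (hτ : τ ∈ R)
    {z : Fin n → ℂ} (hz : z ∈ e.target) : ContDiffAt ℝ 2 (inChart e Φ) (τ, z) :=
  (hΦ.contDiffOn e he).contDiffAt ((hR.prod e.open_target).mem_nhds ⟨hτ, hz⟩)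

lemma eventually_add_mul_mem (hR : IsOpen R) {τ : ℂ} (hτ : τ ∈ R) (a : ℂ) :
    ∀ᶠ s in 𝓝 (0 : ℂ), τ + s * a ∈ closure R := by
  have : Tendsto (fun s : ℂ => τ + s * a) (𝓝 0) (𝓝 τ) := by
    have : Continuous fun s : ℂ => τ + s * a := by fun_prop
    simpa using this.tendsto 0
  filter_upwards [this.eventually (hR.mem_nhds hτ)] with s hs using subset_closure hs

/-- Comparison principle for solutions with the same boundary values. -/
theorem IsSolution.le_of_boundary_eq [CompactSpace V] (hR : IsOpen R) (hRb : Bornology.IsBounded R)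
    (hb : IsConstKahlerMetric b) (hε : 0 < ε) (hΦ : IsSolution R b ε F Φ)
    (hΨ : IsSolution R b ε F Ψ) : ∀ τ ∈ closure R, ∀ x, Φ τ x ≤ Ψ τ x := by
  intro τ₁ hτ₁ x₁
  by_contra! hlt
  have hcpt : IsCompact (closure R) := hRb.isCompact_closure
  obtain ⟨K, hK⟩ := (hcpt.image (continuous_norm.pow 2)).bddAbove
  have hK' : ∀ τ ∈ closure R, ‖τ‖ ^ 2 ≤ K := fun τ hτ => hK ⟨τ, hτ, rfl⟩
  have hK0 : 0 ≤ K := (sq_nonneg _).trans (hK' τ₁ hτ₁)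
  set d := Φ τ₁ x₁ - Ψ τ₁ x₁ with hd
  have hd0 : 0 < d := sub_pos.2 hlt
  set κ := d / (2 * (K + 1)) with hκ
  have hκ0 : 0 < κ := by positivity
  have hcont : ContinuousOn (fun q : ℂ × V => Φ q.1 q.2 - Ψ q.1 q.2 + κ * ‖q.1‖ ^ 2)
      (closure R ×ˢ univ) :=
    (hΦ.continuousOn.sub hΨ.continuousOn).add (by fun_prop)
  obtain ⟨⟨τ₀, x₀⟩, ⟨hτ₀, -⟩, hmax⟩ := (hcpt.prod isCompact_univ).exists_isMaxOn
    ⟨(τ₁, x₁), hτ₁, mem_univ _⟩ hcont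
  have hmax' : ∀ τ ∈ closure R, ∀ x,
      Φ τ x - Ψ τ x + κ * ‖τ‖ ^ 2 ≤ Φ τ₀ x₀ - Ψ τ₀ x₀ + κ * ‖τ₀‖ ^ 2 :=
    fun τ hτ x => hmax (a := (τ, x)) ⟨hτ, mem_univ _⟩
  have hτ₀R : τ₀ ∈ R := by
    by_contra hnot
    have hfr : τ₀ ∈ frontier R := by rw [hR.frontier_eq]; exact ⟨hτ₀, hnot⟩
    have h1 := hmax' τ₁ hτ₁ x₁
    rw [hΦ.boundary _ hfr, hΨ.boundary _ hfr, sub_self, zero_add, ← hd] at h1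
    have h2 : κ * ‖τ₀‖ ^ 2 ≤ κ * K := mul_le_mul_of_nonneg_left (hK' _ hτ₀) hκ0.le
    have h3 : 0 ≤ κ * ‖τ₁‖ ^ 2 := by positivity
    have h4 : κ * K < d := by
      rw [hκ, div_mul_eq_mul_div, div_lt_iff₀ (by positivity)]
      nlinarith
    linarith
  have he := chart_mem_atlas (Fin n → ℂ) x₀
  set e := chartAt (Fin n → ℂ) x₀ with hedef
  have hx : x₀ ∈ e.source := mem_chart_source _ x₀
  have hz : e x₀ ∈ e.target := e.map_source hx
  have c1 := hΦ.contDiffAt hR he hτ₀R hz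
  have c2 := hΨ.contDiffAt hR he hτ₀R hz
  have key : ∀ (a : ℂ) (W : Fin n → ℂ),
      (mixedDeriv (inChart e Φ) (τ₀, e x₀) (a, W) (a, W)).re + κ * ‖a‖ ^ 2 ≤
        (mixedDeriv (inChart e Ψ) (τ₀, e x₀) (a, W) (a, W)).re := by
    intro a W
    refine mixedDeriv_sub_le c1 c2 ?_
    filter_upwards [eventually_add_mul_mem hR hτ₀R a] with s hs
    simp only [inChart, e.left_inv hx]
    exact hmax' _ hs _
  have p1 := hΦ.posDef e he τ₀ hτ₀R x₀ hx
  have p2 := hΨ.posDef e he τ₀ hτ₀R x₀ hx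
  have q1 := hΦ.equation e he τ₀ hτ₀R x₀ hx
  have q2 := hΨ.equation e he τ₀ hτ₀R x₀ hx
  rw [productForm_eq_coordForm] at p1 p2 q1 q2
  -- Testing with the direction optimal for `Ψ` bounds the form of `Φ` by `ε` times the trace for
  -- `Ψ`, minus `κ`. At the maximum the metric of `Φ` is the smaller one, so its trace is the larger
  -- one, contradicting the lower bound for `Φ`.
  obtain ⟨W, hW⟩ := exists_lineForm_eq p2 q2
  have h1 := le_lineForm p1 q1 W
  rw [lineForm_coordForm c1] at h1
  rw [lineForm_coordForm c2] at hW
  have h2 := key 1 W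
  rw [norm_one, one_pow, mul_one] at h2
  have h3 := traceInv_anti (hb.posDef e he) (posDef_toBlocks₂₂ p1) (posDef_toBlocks₂₂ p2)
    (fun ξ => by
      rw [hermForm_toBlocks₂₂_coordForm, hermForm_toBlocks₂₂_coordForm]
      have := key 0 ξ
      simp only [norm_zero, ne_eq, OfNat.ofNat_ne_zero, not_false_eq_true, zero_pow, mul_zero,
        add_zero] at this
      linarith)
  have h4 := mul_le_mul_of_nonneg_left h3 hε.le
  linarith

theorem IsSolution.eq_of_boundary_eq [CompactSpace V] (hR : IsOpen R)
    (hRb : Bornology.IsBounded R) (hb : IsConstKahlerMetric b) (hε : 0 < ε)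
    (hΦ : IsSolution R b ε F Φ) (hΨ : IsSolution R b ε F Ψ) {τ : ℂ} (hτ : τ ∈ closure R) :
    Φ τ = Ψ τ :=
  funext fun x => le_antisymm (hΦ.le_of_boundary_eq hR hRb hb hε hΨ τ hτ x)
    (hΨ.le_of_boundary_eq hR hRb hb hε hΦ τ hτ x)

/-- A solution whose boundary values vanish does not depend on the point of `V`. -/
theorem IsSolution.le_of_boundary_zero [CompactSpace V] (hR : IsOpen R)
    (hRb : Bornology.IsBounded R) (hb : IsConstKahlerMetric b) (hε : 0 < ε)
    (hΦ : IsSolution R b ε F Φ) (hF : ∀ τ x, F τ x = 0) :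
    ∀ τ ∈ closure R, ∀ x y, Φ τ x ≤ Φ τ y := by
  intro τ₁ hτ₁ x₁ y₁
  by_contra! hlt
  have hcpt : IsCompact (closure R) := hRb.isCompact_closure
  obtain ⟨K, hK⟩ := (hcpt.image (continuous_norm.pow 2)).bddAbove
  have hK' : ∀ τ ∈ closure R, ‖τ‖ ^ 2 ≤ K := fun τ hτ => hK ⟨τ, hτ, rfl⟩
  have hK0 : 0 ≤ K := (sq_nonneg _).trans (hK' τ₁ hτ₁)
  set d := Φ τ₁ x₁ - Φ τ₁ y₁ with hd
  have hd0 : 0 < d := sub_pos.2 hlt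
  set κ := d / (2 * (K + 1)) with hκ
  have hκ0 : 0 < κ := by positivity
  have hcont : ContinuousOn (fun q : ℂ × V × V => Φ q.1 q.2.1 - Φ q.1 q.2.2 + κ * ‖q.1‖ ^ 2)
      (closure R ×ˢ univ) := by
    refine (ContinuousOn.sub ?_ ?_).add (by fun_prop)
    · exact hΦ.continuousOn.comp (f := fun q : ℂ × V × V => (q.1, q.2.1)) (by fun_prop)
        fun q hq => ⟨hq.1, mem_univ _⟩
    · exact hΦ.continuousOn.comp (f := fun q : ℂ × V × V => (q.1, q.2.2)) (by fun_prop)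
        fun q hq => ⟨hq.1, mem_univ _⟩
  obtain ⟨⟨τ₀, x₀, y₀⟩, ⟨hτ₀, -⟩, hmax⟩ := (hcpt.prod isCompact_univ).exists_isMaxOn
    ⟨(τ₁, x₁, y₁), hτ₁, mem_univ _⟩ hcont
  have hmax' : ∀ τ ∈ closure R, ∀ x y,
      Φ τ x - Φ τ y + κ * ‖τ‖ ^ 2 ≤ Φ τ₀ x₀ - Φ τ₀ y₀ + κ * ‖τ₀‖ ^ 2 :=
    fun τ hτ x y => hmax (a := (τ, x, y)) ⟨hτ, mem_univ _⟩
  have hτ₀R : τ₀ ∈ R := by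
    by_contra hnot
    have hfr : τ₀ ∈ frontier R := by rw [hR.frontier_eq]; exact ⟨hτ₀, hnot⟩
    have h1 := hmax' τ₁ hτ₁ x₁ y₁
    rw [hΦ.boundary _ hfr, hΦ.boundary _ hfr, hF, hF, sub_self, zero_add, ← hd] at h1
    have h2 : κ * ‖τ₀‖ ^ 2 ≤ κ * K := mul_le_mul_of_nonneg_left (hK' _ hτ₀) hκ0.le
    have h3 : 0 ≤ κ * ‖τ₁‖ ^ 2 := by positivity
    have h4 : κ * K < d := by
      rw [hκ, div_mul_eq_mul_div, div_lt_iff₀ (by positivity)]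
      nlinarith
    linarith
  have he := chart_mem_atlas (Fin n → ℂ) x₀
  set e := chartAt (Fin n → ℂ) x₀ with hedef
  have hx : x₀ ∈ e.source := mem_chart_source _ x₀
  have he' := chart_mem_atlas (Fin n → ℂ) y₀
  set e' := chartAt (Fin n → ℂ) y₀ with hedef'
  have hy : y₀ ∈ e'.source := mem_chart_source _ y₀
  have c1 := hΦ.contDiffAt hR he hτ₀R (e.map_source hx)
  have c2 := hΦ.contDiffAt hR he' hτ₀R (e'.map_source hy)
  have key : ∀ (a : ℂ) (W W' : Fin n → ℂ),
      (mixedDeriv (inChart e Φ) (τ₀, e x₀) (a, W) (a, W)).re + κ * ‖a‖ ^ 2 ≤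
        (mixedDeriv (inChart e' Φ) (τ₀, e' y₀) (a, W') (a, W')).re := by
    intro a W W'
    refine mixedDeriv_sub_le c1 c2 ?_
    filter_upwards [eventually_add_mul_mem hR hτ₀R a] with s hs
    simp only [inChart, e.left_inv hx, e'.left_inv hy]
    exact hmax' _ hs _ _
  have hz : ∀ (f : ℂ × (Fin n → ℂ) → ℝ) q, (mixedDeriv f q (0, 0) (0, 0)).re = 0 := by
    intro f q
    rw [Prod.mk_zero_zero, mixedDeriv_self_re]
    simp [realHess]
  have p1 := hΦ.posDef e he τ₀ hτ₀R x₀ hx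
  have p2 := hΦ.posDef e' he' τ₀ hτ₀R y₀ hy
  have q1 := hΦ.equation e he τ₀ hτ₀R x₀ hx
  have q2 := hΦ.equation e' he' τ₀ hτ₀R y₀ hy
  rw [productForm_eq_coordForm] at p1 p2 q1 q2
  -- The maximum in independent vertical directions at `x₀` and `y₀` gives `g(x₀) ≤ ω₀ ≤ g(y₀)`, so
  -- the traces lie on opposite sides of `n`. The directions `(1, 0)` at `x₀` and `(1, W)` at `y₀`
  -- then yield `ε n + κ ≤ ε n`.
  obtain ⟨W, hW⟩ := exists_lineForm_eq p2 q2
  have h1 := le_lineForm p1 q1 0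
  rw [lineForm_coordForm c1] at h1
  rw [lineForm_coordForm c2] at hW
  have h2 := key 1 0 W
  rw [norm_one, one_pow, mul_one] at h2
  have h3 := traceInv_anti (hb.posDef e he) (posDef_toBlocks₂₂ p1) (hb.posDef e he)
    (fun ξ => by
      rw [hermForm_toBlocks₂₂_coordForm]
      have := key 0 ξ 0
      rw [hz, norm_zero] at this
      linarith)
  have h4 := traceInv_anti (hb.posDef e' he') (hb.posDef e' he') (posDef_toBlocks₂₂ p2)
    (fun ξ => by
      rw [hermForm_toBlocks₂₂_coordForm]
      have := key 0 0 ξ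
      rw [hz, norm_zero] at this
      linarith)
  rw [traceInv_self (hb.posDef e he)] at h3
  rw [traceInv_self (hb.posDef e' he')] at h4
  have h5 := mul_le_mul_of_nonneg_left h3 hε.le
  have h6 := mul_le_mul_of_nonneg_left h4 hε.le
  have h7 : hermForm (b e) 0 = 0 := by simp [hermForm]
  have h8 := hermForm_nonneg (hb.posDef e' he') W
  linarith

end Comparison

/-! ### Unique differentiability up to the boundary. -/

section SmoothBoundary

/-- The closure of a domain with smooth boundary contains a truncated open cone at each boundary
point. -/
lemma IsSmoothBoundedDomain.uniqueDiffOn_closure {R : Set ℂ} (hR : IsSmoothBoundedDomain R) :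
    UniqueDiffOn ℝ (closure R) := by
  intro p hp
  by_cases hpR : p ∈ R
  · exact (hR.isOpen.uniqueDiffWithinAt hpR).mono subset_closure
  have hfr : p ∈ frontier R := by rw [hR.isOpen.frontier_eq]; exact ⟨hp, hpR⟩
  obtain ⟨U, hU, hpU, ρ, hρ, hρ', hRU⟩ := hR.smooth_boundary p hfr
  have hρd : ContDiffAt ℝ ∞ ρ p := hρ.contDiffAt (hU.mem_nhds hpU)
  have hdiff : HasFDerivAt ρ (fderiv ℝ ρ p) p := (hρd.differentiableAt (by simp)).hasFDerivAt
  set l := fderiv ℝ ρ p with hl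
  have hρp : ρ p ≤ 0 := by
    by_contra! hpos
    have h1 : ∀ᶠ q in 𝓝 p, q ∈ U ∧ 0 < ρ q :=
      (hU.eventually_mem hpU).and (hρd.continuousAt.eventually (lt_mem_nhds hpos))
    obtain ⟨q, ⟨hqU, hq⟩, hqR⟩ := mem_closure_iff_nhds.1 hp _ h1
    have : q ∈ R ∩ U := ⟨hqR, hqU⟩
    rw [hRU] at this
    exact absurd this.2 (not_lt.2 hq.le)
  obtain ⟨v, hv⟩ : ∃ v, l v < 0 := by
    obtain ⟨w, hw⟩ : ∃ w, l w ≠ 0 := by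
      by_contra! h
      exact hρ' p hpU (ContinuousLinearMap.ext h)
    rcases lt_or_gt_of_ne hw with h | h
    · exact ⟨w, h⟩
    · exact ⟨-w, by simpa using h⟩
  have hv0 : 0 < ‖v‖ := by
    refine norm_pos_iff.2 ?_
    rintro rfl
    simp at hv
  -- Half the slope of `l` along `v`: small enough that `v` lies in the cone `l w + c‖w‖ < 0`, and
  -- positive, so that near `p` the linearization error is at most `c‖q - p‖` and `ρ` stays negative
  -- on the cone.
  set c := -l v / (2 * ‖v‖) with hc
  have hc0 : 0 < c := div_pos (by linarith) (by positivity)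
  have hcv : c * ‖v‖ = -l v / 2 := by rw [hc]; field_simp
  obtain ⟨r, hr, hball⟩ := Metric.eventually_nhds_iff_ball.1
    ((hU.eventually_mem hpU).and (hdiff.isLittleO.def hc0))
  set s : Set ℂ := {q | l q + c * ‖q - p‖ < l p} ∩ Metric.ball p r with hs
  have hsR : s ⊆ R := by
    rintro q ⟨hq1, hq2⟩
    obtain ⟨hqU, hq3⟩ := hball q hq2
    have h1 := (le_abs_self _).trans hq3
    have hq1 : l q + c * ‖q - p‖ < l p := hq1
    have h2 : ρ q < 0 := by
      rw [map_sub] at h1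
      linarith
    have : q ∈ R ∩ U := by rw [hRU]; exact ⟨hqU, h2⟩
    exact this.1
  have hconv : Convex ℝ s := by
    refine Convex.inter ?_ (convex_ball p r)
    have h1 : ConvexOn ℝ univ fun q : ℂ => l q + c * ‖q - p‖ := by
      refine ConvexOn.add (l.toLinearMap.convexOn convex_univ) ?_
      have := (convexOn_dist p convex_univ (E := ℂ)).smul hc0.le
      simpa [dist_eq_norm] using this
    simpa using h1.convex_lt (l p)
  have hopen : IsOpen s := by
    refine IsOpen.inter (isOpen_lt ?_ continuous_const) Metric.isOpen_ball
    fun_prop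
  have hline : Tendsto (fun t : ℝ => p + t • v) (𝓝[>] 0) (𝓝 p) := by
    have : Continuous fun t : ℝ => p + t • v := by fun_prop
    simpa using (this.tendsto 0).mono_left nhdsWithin_le_nhds
  have hev : ∀ᶠ t : ℝ in 𝓝[>] 0, p + t • v ∈ s := by
    filter_upwards [hline.eventually (Metric.ball_mem_nhds p hr), self_mem_nhdsWithin] with t h1 h2
    have h2 : 0 < t := h2
    refine ⟨?_, h1⟩
    change l (p + t • v) + c * ‖p + t • v - p‖ < l p
    rw [map_add, map_smul, add_sub_cancel_left, norm_smul, Real.norm_of_nonneg h2.le, smul_eq_mul]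
    nlinarith
  have hps : p ∈ closure s := mem_closure_of_tendsto hline hev
  obtain ⟨t, ht⟩ := hev.exists
  exact (uniqueDiffWithinAt_convex hconv (by rw [hopen.interior_eq]; exact ⟨_, ht⟩) hps).mono
    (hsR.trans subset_closure)

end SmoothBoundary

/-! ### Hessians along the fibres `{τ} × V`. -/

section Slices

variable {n : ℕ}

lemma contDiffOn_slice {k : ℕ∞ω} {f : ℂ × (Fin n → ℂ) → ℝ} {A : Set ℂ} {U : Set (Fin n → ℂ)}
    (hf : ContDiffOn ℝ k f (A ×ˢ U)) {τ : ℂ} (hτ : τ ∈ A) :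
    ContDiffOn ℝ k (fun z => f (τ, z)) U :=
  hf.comp (f := fun z => (τ, z)) (by fun_prop) fun _ hz => ⟨hτ, hz⟩

/-- For `τ` on the boundary the full Hessian is only a derivative within the closed set, while the
fibre Hessian is an ordinary derivative. Identifying the two lets `C²` continuity of the path
control the fibre Hessian up to the boundary. -/
lemma realHess_slice {f : ℂ × (Fin n → ℂ) → ℝ} {A : Set ℂ} {U : Set (Fin n → ℂ)}
    (hf : ContDiffOn ℝ 2 f (A ×ˢ U)) (hA : UniqueDiffOn ℝ A) (hU : IsOpen U) {τ : ℂ} (hτ : τ ∈ A)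
    {z : Fin n → ℂ} (hz : z ∈ U) (ξ η : Fin n → ℂ) :
    realHess (fun z => f (τ, z)) z ξ η =
      iteratedFDerivWithin ℝ 2 f (A ×ˢ U) (τ, z) ![(0, ξ), (0, η)] := by
  have hs : UniqueDiffOn ℝ (A ×ˢ U) := hA.prod hU.uniqueDiffOn
  rw [iteratedFDerivWithin_two_apply' f hs ⟨hτ, hz⟩]
  set ι := ContinuousLinearMap.inr ℝ ℂ (Fin n → ℂ) with hι
  have hι' : ∀ y, HasFDerivAt (fun z : Fin n → ℂ => (τ, z)) ι y := fun y =>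
    hasFDerivAt_prodMk_right τ y
  have slice : ∀ {G : Type} [NormedAddCommGroup G] [NormedSpace ℝ G] (g : ℂ × (Fin n → ℂ) → G),
      DifferentiableOn ℝ g (A ×ˢ U) → ∀ y ∈ U,
        HasFDerivAt (fun z => g (τ, z)) ((fderivWithin ℝ g (A ×ˢ U) (τ, y)).comp ι) y := by
    intro G _ _ g hg y hy
    have h1 := (hg (τ, y) ⟨hτ, hy⟩).hasFDerivWithinAt
    have h2 := h1.comp y (hι' y).hasFDerivWithinAt (s := U) fun w hw => ⟨hτ, hw⟩
    exact h2.hasFDerivAt (hU.mem_nhds hy)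
  have e1 : fderiv ℝ (fun z => f (τ, z)) =ᶠ[𝓝 z]
      fun y => (fderivWithin ℝ f (A ×ˢ U) (τ, y)).comp ι := by
    filter_upwards [hU.mem_nhds hz] with y hy
    exact (slice f (hf.differentiableOn (by simp)) y hy).fderiv
  have e2 := slice (fderivWithin ℝ f (A ×ˢ U))
    ((hf.fderivWithin hs (m := 1) (by norm_num)).differentiableOn (by simp)) z hz
  have e3 := ((ContinuousLinearMap.compL ℝ (Fin n → ℂ) (ℂ × (Fin n → ℂ)) ℝ).flip ι).hasFDerivAt.comp
    z e2
  have e4 : HasFDerivAt (fun y => (fderivWithin ℝ f (A ×ˢ U) (τ, y)).comp ι) _ z := e3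
  rw [realHess, e1.fderiv_eq, e4.fderiv]
  simp [hι]

lemma realHess_slice_eq {f : ℂ × (Fin n → ℂ) → ℝ} {τ : ℂ} {z : Fin n → ℂ}
    (hf : ContDiffAt ℝ 2 f (τ, z)) (ξ : Fin n → ℂ) :
    realHess (fun z => f (τ, z)) z ξ ξ = realHess f (τ, z) (0, ξ) (0, ξ) := by
  have h1 : ContDiffAt ℝ 2 (fun z => f (τ, z)) z :=
    hf.comp z (f := fun z => (τ, z)) (by fun_prop)
  refine (hasSecondDiff_line h1 ξ).unique ((hasSecondDiff_line hf (0, ξ)).congr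
    (Eventually.of_forall fun r => ?_))
  simp

end Slices

/-! ### Invariance under affine changes of chart. -/

section Transition

variable {n : ℕ} {V : Type*} [TopologicalSpace V] [ChartedSpace (Fin n → ℂ) V]
  [HasGroupoid V (affineGroupoid n)]

lemma exists_affine_transition {e e' : OpenPartialHomeomorph V (Fin n → ℂ)}
    (he : e ∈ atlas (Fin n → ℂ) V) (he' : e' ∈ atlas (Fin n → ℂ) V) {x : V} (hx : x ∈ e.source)
    (hx' : x ∈ e'.source) :
    ∃ A : (Fin n → ℂ) →ᵃ[ℂ] (Fin n → ℂ), (fun z => e' (e.symm z)) =ᶠ[𝓝 (e x)] A ∧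
      ∀ ξ, transitionJacobian e e' x *ᵥ ξ = A.linear ξ := by
  have h := (mem_groupoid_of_pregroupoid.1
    (HasGroupoid.compatible (G := affineGroupoid n) he he')).1
  obtain ⟨A, hA⟩ := h (e x) (by simp [hx, hx'])
  refine ⟨A, hA, fun ξ => ?_⟩
  have hA' : (fun z => e' (e.symm z)) =ᶠ[𝓝 (e x)] A := hA
  have hd : HasFDerivAt (𝕜 := ℂ) A (LinearMap.toContinuousLinearMap A.linear) (e x) := by
    have := (LinearMap.toContinuousLinearMap A.linear).hasFDerivAt (x := e x) |>.add_const (A 0)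
    refine this.congr_of_eventuallyEq (Eventually.of_forall fun z => ?_)
    exact congrFun A.decomp z
  have hJ : ∀ μ α, transitionJacobian e e' x μ α = A.linear (Pi.single α 1) μ := by
    intro μ α
    rw [transitionJacobian, of_apply, hA'.fderiv_eq, hd.fderiv]
    rfl
  conv_rhs => rw [← sum_smul_single ξ, map_sum]
  ext μ
  simp [mulVec, dotProduct, hJ, mul_comm]

/-- An affine transition maps lines to lines, so the Hessian transforms as a tensor with no
first-derivative term. -/
lemma realHess_transition {e e' : OpenPartialHomeomorph V (Fin n → ℂ)}
    (he : e ∈ atlas (Fin n → ℂ) V) (he' : e' ∈ atlas (Fin n → ℂ) V) {x : V} (hx : x ∈ e.source)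
    (hx' : x ∈ e'.source) {φ : V → ℝ} (h : ContDiffAt ℝ 2 (fun z => φ (e.symm z)) (e x))
    (h' : ContDiffAt ℝ 2 (fun z => φ (e'.symm z)) (e' x)) (ξ : Fin n → ℂ) :
    realHess (fun z => φ (e.symm z)) (e x) ξ ξ =
      realHess (fun z => φ (e'.symm z)) (e' x) (transitionJacobian e e' x *ᵥ ξ)
        (transitionJacobian e e' x *ᵥ ξ) := by
  obtain ⟨A, hA, hJ⟩ := exists_affine_transition he he' hx hx'
  rw [hJ]
  refine (hasSecondDiff_line h ξ).unique ((hasSecondDiff_line h' (A.linear ξ)).congr ?_)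
  have hl : Tendsto (fun r : ℝ => e x + r • ξ) (𝓝 0) (𝓝 (e x)) := by
    have : Continuous fun r : ℝ => e x + r • ξ := by fun_prop
    simpa using this.tendsto 0
  have hs : ∀ᶠ z in 𝓝 (e x), e.symm z ∈ e'.source := by
    have hc := e.continuousAt_symm (e.map_source hx)
    rw [ContinuousAt, e.left_inv hx] at hc
    exact hc.eventually (e'.open_source.mem_nhds hx')
  filter_upwards [hl.eventually hA, hl.eventually hs] with r h1 h2
  have h3 : A (e x) = e' x := by
    rw [← hA.self_of_nhds]
    exact congrArg e' (e.left_inv hx)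
  have h4 : A (e x + r • ξ) = e' x + r • A.linear ξ := by
    have := A.map_vadd (e x) ((r : ℂ) • ξ)
    rw [vadd_eq_add, vadd_eq_add, h3, map_smul, add_comm, add_comm _ (e' x)] at this
    exact this
  rw [← h4, ← h1, e'.left_inv h2]

omit [HasGroupoid V (affineGroupoid n)] in
lemma IsConstKahlerMetric.hermForm_transition
    {b : OpenPartialHomeomorph V (Fin n → ℂ) → Matrix (Fin n) (Fin n) ℂ}
    (hb : IsConstKahlerMetric b) {e e' : OpenPartialHomeomorph V (Fin n → ℂ)}
    (he : e ∈ atlas (Fin n → ℂ) V) (he' : e' ∈ atlas (Fin n → ℂ) V) {x : V} (hx : x ∈ e.source)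
    (hx' : x ∈ e'.source) (ξ : Fin n → ℂ) :
    hermForm (b e) ξ = hermForm (b e') (transitionJacobian e e' x *ᵥ ξ) := by
  rw [hb.compat e he e' he' x ⟨hx, hx'⟩, hermForm, hermForm, star_mulVec_conjMat,
    ← mulVec_mulVec, ← mulVec_mulVec, dotProduct_mulVec, vecMul_transpose]

omit [HasGroupoid V (affineGroupoid n)] in
lemma IsConstSection.symmForm_transition
    {T : OpenPartialHomeomorph V (Fin n → ℂ) → Matrix (Fin n) (Fin n) ℂ}
    (hT : IsConstSection T) {e e' : OpenPartialHomeomorph V (Fin n → ℂ)}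
    (he : e ∈ atlas (Fin n → ℂ) V) (he' : e' ∈ atlas (Fin n → ℂ) V) {x : V} (hx : x ∈ e.source)
    (hx' : x ∈ e'.source) (ξ : Fin n → ℂ) :
    symmForm (T e) ξ = symmForm (T e') (transitionJacobian e e' x *ᵥ ξ) := by
  rw [hT.compat e he e' he' x ⟨hx, hx'⟩, symmForm, symmForm,
    ← mulVec_mulVec, ← mulVec_mulVec, dotProduct_mulVec, vecMul_transpose]

omit [HasGroupoid V (affineGroupoid n)] in
lemma IsConstKahlerMetric.transition_mulVec_ne_zero
    {b : OpenPartialHomeomorph V (Fin n → ℂ) → Matrix (Fin n) (Fin n) ℂ}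
    (hb : IsConstKahlerMetric b) {e e' : OpenPartialHomeomorph V (Fin n → ℂ)}
    (he : e ∈ atlas (Fin n → ℂ) V) (he' : e' ∈ atlas (Fin n → ℂ) V) {x : V} (hx : x ∈ e.source)
    (hx' : x ∈ e'.source) {ξ : Fin n → ℂ} (hξ : ξ ≠ 0) : transitionJacobian e e' x *ᵥ ξ ≠ 0 := by
  intro h0
  have h1 := hermForm_pos (hb.posDef e he) hξ
  rw [hb.hermForm_transition he he' hx hx', h0] at h1
  simp [hermForm] at h1

end Transition

/-! ### Compactness of the set of degenerate parameters. -/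

section Compactness

lemma continuousOn_uncurry_of_tendstoUniformlyOn {S X Y : Type*} [TopologicalSpace S]
    [TopologicalSpace X] [PseudoMetricSpace Y] {D : S → X → Y} {I : Set S} {K : Set X}
    (hD : ∀ σ ∈ I, ContinuousOn (D σ) K)
    (hu : ∀ σ₀ ∈ I, TendstoUniformlyOn D (D σ₀) (𝓝[I] σ₀) K) :
    ContinuousOn (fun q : S × X => D q.1 q.2) (I ×ˢ K) := by
  rintro ⟨σ₀, x₀⟩ ⟨hσ, hx⟩
  rw [ContinuousWithinAt, nhdsWithin_prod_eq, Metric.tendsto_nhds]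
  intro η hη
  have h1 := Metric.tendstoUniformlyOn_iff.1 (hu σ₀ hσ) (η / 2) (by positivity)
  have h2 := Metric.tendsto_nhds.1 (hD σ₀ hσ x₀ hx) (η / 2) (by positivity)
  filter_upwards [h1.prod_mk (h2.and self_mem_nhdsWithin)] with q hq
  have h3 := hq.1 q.2 hq.2.2
  have h4 := hq.2.1
  calc dist (D q.1 q.2) (D σ₀ x₀) ≤ dist (D q.1 q.2) (D σ₀ q.2) + dist (D σ₀ q.2) (D σ₀ x₀) :=
        dist_triangle _ _ _
    _ < η / 2 + η / 2 := by rw [dist_comm (D q.1 q.2)]; exact add_lt_add h3 h4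
    _ = η := add_halves η

variable {n : ℕ} {V : Type*} [TopologicalSpace V] [ChartedSpace (Fin n → ℂ) V]

/-- The parameters for which a continuous family of quadratic forms on the tangent bundle of a
compact manifold fails to be positive definite form a compact set. -/
lemma isCompact_setOf_not_pos [CompactSpace V] {P : Type*} [TopologicalSpace P] [T2Space P]
    {C : Set P} (hC : IsCompact C)
    (q : P → OpenPartialHomeomorph V (Fin n → ℂ) → (Fin n → ℂ) → (Fin n → ℂ) → ℝ)
    (hcont : ∀ e ∈ atlas (Fin n → ℂ) V, ∀ K : Set (Fin n → ℂ), IsCompact K → K ⊆ e.target →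
      ContinuousOn (fun y : P × (Fin n → ℂ) × (Fin n → ℂ) => q y.1 e y.2.1 y.2.2)
        (C ×ˢ K ×ˢ univ))
    (hcompat : ∀ p ∈ C, ∀ e ∈ atlas (Fin n → ℂ) V, ∀ e' ∈ atlas (Fin n → ℂ) V, ∀ x ∈ e.source,
      x ∈ e'.source → ∀ ξ ≠ 0, ∃ η ≠ 0, q p e (e x) ξ = q p e' (e' x) η)
    (hhom : ∀ p e z ξ, ∀ r : ℝ, q p e z (r • ξ) = r ^ 2 * q p e z ξ) :
    IsCompact {p ∈ C | ∃ e ∈ atlas (Fin n → ℂ) V, ∃ z ∈ e.target, ∃ ξ ≠ 0, q p e z ξ ≤ 0} := by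
  have hloc : ∀ x : V, ∃ K : Set (Fin n → ℂ), IsCompact K ∧
      K ⊆ (chartAt (Fin n → ℂ) x).target ∧ K ∈ 𝓝 (chartAt (Fin n → ℂ) x x) := by
    intro x
    obtain ⟨K, hK, hKt, hKc⟩ := local_compact_nhds
      ((chartAt (Fin n → ℂ) x).open_target.mem_nhds (mem_chart_target (Fin n → ℂ) x))
    exact ⟨K, hKc, hKt, hK⟩
  choose K hKc hKt hKn using hloc
  obtain ⟨t, -, ht⟩ := isCompact_univ.elim_nhds_subcover
    (fun x : V => (chartAt (Fin n → ℂ) x).source ∩ chartAt (Fin n → ℂ) x ⁻¹' K x)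
    (fun x _ => inter_mem (chart_source_mem_nhds _ x)
      ((mem_chart_source (Fin n → ℂ) x |> (chartAt (Fin n → ℂ) x).continuousAt) (hKn x)))
  have hne0 : ∀ ξ ∈ Metric.sphere (0 : Fin n → ℂ) 1, ξ ≠ 0 := by
    rintro ξ hξ rfl
    simp at hξ
  -- Finitely many compact coordinate pieces cover `V`. Chart compatibility moves a bad vector into
  -- one of them, and homogeneity normalizes it to the unit sphere, so the bad set is a finite union
  -- of projections of compact sets.
  have key : {p ∈ C | ∃ e ∈ atlas (Fin n → ℂ) V, ∃ z ∈ e.target, ∃ ξ ≠ 0, q p e z ξ ≤ 0} =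
      ⋃ x ∈ t, Prod.fst '' ((C ×ˢ K x ×ˢ Metric.sphere (0 : Fin n → ℂ) 1) ∩
        (fun y : P × (Fin n → ℂ) × (Fin n → ℂ) => q y.1 (chartAt (Fin n → ℂ) x) y.2.1 y.2.2) ⁻¹'
          Iic 0) := by
    ext p
    simp only [mem_iUnion, mem_image, Prod.exists, exists_and_right, exists_eq_right]
    constructor
    · rintro ⟨hp, e, he, z, hz, ξ, hξ, hq⟩
      obtain ⟨x, hxt, hx1, hx2⟩ := mem_iUnion₂.1 (ht (mem_univ (e.symm z)))
      obtain ⟨η, hη, heq⟩ := hcompat p hp e he _ (chart_mem_atlas (Fin n → ℂ) x) (e.symm z)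
        (e.map_target hz) hx1 ξ hξ
      rw [e.right_inv hz] at heq
      have hn : ‖η‖ ≠ 0 := norm_ne_zero_iff.2 hη
      refine ⟨x, hxt, _, ‖η‖⁻¹ • η, ⟨hp, hx2, by simp [norm_smul, hn]⟩, ?_⟩
      change q p _ (chartAt (Fin n → ℂ) x (e.symm z)) _ ≤ 0
      rw [hhom, ← heq]
      exact mul_nonpos_of_nonneg_of_nonpos (sq_nonneg _) hq
    · rintro ⟨x, hxt, z, ξ, ⟨hp, hz, hξ⟩, hq⟩
      exact ⟨hp, _, chart_mem_atlas _ x, z, hKt x hz, ξ, hne0 ξ hξ, hq⟩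
  rw [key]
  refine t.finite_toSet.isCompact_biUnion fun x _ => IsCompact.image ?_ continuous_fst
  have hD : IsCompact (C ×ˢ K x ×ˢ Metric.sphere (0 : Fin n → ℂ) 1) :=
    hC.prod ((hKc x).prod (isCompact_sphere 0 1))
  refine hD.of_isClosed_subset ?_ inter_subset_left
  exact ((hcont _ (chart_mem_atlas _ x) (K x) (hKc x) (hKt x)).mono
    (prod_mono subset_rfl (prod_mono subset_rfl (subset_univ _)))).preimage_isClosed_of_isClosed
      hD.isClosed isClosed_Iic

end Compactness

/-! ### The continuity method. -/

section ContinuityPath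

variable {n : ℕ} {V : Type*} [TopologicalSpace V] [ChartedSpace (Fin n → ℂ) V]

/-- The convexity form along a path `Ψ` of functions, with parameters `(κ, σ, τ)`. -/
def pathForm (b T : OpenPartialHomeomorph V (Fin n → ℂ) → Matrix (Fin n) (Fin n) ℂ)
    (Ψ : ℝ → ℂ → V → ℝ) (β : ℝ) (y : ℝ × ℝ × ℂ) (e : OpenPartialHomeomorph V (Fin n → ℂ))
    (z ξ : Fin n → ℂ) : ℝ :=
  1 / 2 * realHess (fun z => Ψ y.2.1 y.2.2 (e.symm z)) z ξ ξ
    + (1 - y.2.1 * β) * hermForm (b e) ξ + y.2.1 * symmForm (T e) ξ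
    - y.1 * ((1 + ‖y.2.2‖ ^ 2) * hermForm (b e) ξ)

variable {b T : OpenPartialHomeomorph V (Fin n → ℂ) → Matrix (Fin n) (Fin n) ℂ}
  {Ψ : ℝ → ℂ → V → ℝ} {R : Set ℂ} {β : ℝ}

omit [ChartedSpace (Fin n → ℂ) V] in
lemma pathForm_smul (y : ℝ × ℝ × ℂ) (e : OpenPartialHomeomorph V (Fin n → ℂ))
    (z ξ : Fin n → ℂ) (r : ℝ) :
    pathForm b T Ψ β y e z (r • ξ) = r ^ 2 * pathForm b T Ψ β y e z ξ := by
  have h1 : hermForm (b e) (r • ξ) = r ^ 2 * hermForm (b e) ξ := by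
    rw [real_smul_vec, hermForm_smul]; simp
  have h2 : symmForm (T e) (r • ξ) = r ^ 2 * symmForm (T e) ξ := by
    rw [real_smul_vec, symmForm_smul, ← Complex.ofReal_pow, Complex.re_ofReal_mul, symmForm]
  rw [pathForm, pathForm, h1, h2]
  simp only [realHess, map_smul, _root_.smul_apply, smul_eq_mul]
  ring

omit [ChartedSpace (Fin n → ℂ) V] in
lemma pathForm_zero (y : ℝ × ℝ × ℂ) (e : OpenPartialHomeomorph V (Fin n → ℂ))
    (z : Fin n → ℂ) : pathForm b T Ψ β y e z 0 = 0 := by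
  simpa using pathForm_smul (b := b) (T := T) (Ψ := Ψ) (β := β) y e z 0 0

lemma IsC4UpToBoundary.contDiffAt_slice {Φ : ℂ → V → ℝ} (h : IsC4UpToBoundary n R Φ)
    {e : OpenPartialHomeomorph V (Fin n → ℂ)} (he : e ∈ atlas (Fin n → ℂ) V) {τ : ℂ}
    (hτ : τ ∈ closure R) {z : Fin n → ℂ} (hz : z ∈ e.target) :
    ContDiffAt ℝ 2 (fun z => Φ τ (e.symm z)) z :=
  ((contDiffOn_slice (h e he) hτ).contDiffAt (e.open_target.mem_nhds hz)).of_le (by norm_num)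

lemma exists_pathForm_transition [HasGroupoid V (affineGroupoid n)] (hb : IsConstKahlerMetric b)
    (hT : IsConstSection T) (hC4 : ∀ σ ∈ Icc (0 : ℝ) 1, IsC4UpToBoundary n R (Ψ σ))
    {y : ℝ × ℝ × ℂ} (hy : y.2.1 ∈ Icc (0 : ℝ) 1) (hy' : y.2.2 ∈ closure R)
    {e e' : OpenPartialHomeomorph V (Fin n → ℂ)}
    (he : e ∈ atlas (Fin n → ℂ) V) (he' : e' ∈ atlas (Fin n → ℂ) V) {x : V} (hx : x ∈ e.source)
    (hx' : x ∈ e'.source) {ξ : Fin n → ℂ} (hξ : ξ ≠ 0) :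
    ∃ η ≠ 0, pathForm b T Ψ β y e (e x) ξ = pathForm b T Ψ β y e' (e' x) η := by
  refine ⟨_, hb.transition_mulVec_ne_zero he he' hx hx' hξ, ?_⟩
  rw [pathForm, pathForm, ← hb.hermForm_transition he he' hx hx',
    ← hT.symmForm_transition he he' hx hx',
    realHess_transition he he' hx hx' ((hC4 _ hy).contDiffAt_slice he hy' (e.map_source hx))
      ((hC4 _ hy).contDiffAt_slice he' hy' (e'.map_source hx'))]

lemma continuousOn_pathForm (hR : UniqueDiffOn ℝ (closure R))
    (hC4 : ∀ σ ∈ Icc (0 : ℝ) 1, IsC4UpToBoundary n R (Ψ σ)) (hcur : IsC2ContinuousCurve n R Ψ)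
    {C : Set (ℝ × ℝ × ℂ)} (hC : C ⊆ univ ×ˢ Icc (0 : ℝ) 1 ×ˢ closure R)
    {e : OpenPartialHomeomorph V (Fin n → ℂ)} (he : e ∈ atlas (Fin n → ℂ) V)
    {K : Set (Fin n → ℂ)} (hK : IsCompact K) (hKe : K ⊆ e.target) :
    ContinuousOn (fun y : (ℝ × ℝ × ℂ) × (Fin n → ℂ) × (Fin n → ℂ) =>
      pathForm b T Ψ β y.1 e y.2.1 y.2.2) (C ×ˢ K ×ˢ univ) := by
  have hs : UniqueDiffOn ℝ (closure R ×ˢ e.target) := hR.prod e.open_target.uniqueDiffOn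
  have hD := continuousOn_uncurry_of_tendstoUniformlyOn (I := Icc (0 : ℝ) 1)
    (K := closure R ×ˢ K)
    (D := fun σ q => iteratedFDerivWithin ℝ 2 (inChart e (Ψ σ)) (closure R ×ˢ e.target) q)
    (fun σ hσ => ((hC4 σ hσ e he).continuousOn_iteratedFDerivWithin (m := 2) (by norm_num) hs).mono
      (prod_mono subset_rfl hKe))
    (fun σ hσ => hcur σ hσ e he K hK hKe 2 le_rfl)
  have hH : ContinuousOn (fun y : (ℝ × ℝ × ℂ) × (Fin n → ℂ) × (Fin n → ℂ) =>
      realHess (fun z => Ψ y.1.2.1 y.1.2.2 (e.symm z)) y.2.1 y.2.2 y.2.2) (C ×ˢ K ×ˢ univ) := by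
    have h1 : ContinuousOn (fun y : (ℝ × ℝ × ℂ) × (Fin n → ℂ) × (Fin n → ℂ) =>
        iteratedFDerivWithin ℝ 2 (inChart e (Ψ y.1.2.1)) (closure R ×ˢ e.target)
          (y.1.2.2, y.2.1)) (C ×ˢ K ×ˢ univ) :=
      hD.comp (f := fun y : (ℝ × ℝ × ℂ) × (Fin n → ℂ) × (Fin n → ℂ) =>
        (y.1.2.1, (y.1.2.2, y.2.1))) (by fun_prop)
        fun y hy => ⟨(hC hy.1).2.1, (hC hy.1).2.2, hy.2.1⟩
    have h2 : Continuous (fun y : (ℝ × ℝ × ℂ) × (Fin n → ℂ) × (Fin n → ℂ) =>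
        (![((0 : ℂ), y.2.2), (0, y.2.2)] : Fin 2 → ℂ × (Fin n → ℂ))) := by
      refine continuous_pi fun i => ?_
      fin_cases i <;>
      · simp only [Fin.zero_eta, Fin.mk_one, Matrix.cons_val_zero, Matrix.cons_val_one]
        fun_prop
    refine (h1.eval h2.continuousOn).congr fun y hy => ?_
    exact realHess_slice ((hC4 _ (hC hy.1).2.1 e he).of_le (by norm_num)) hR e.open_target
      (hC hy.1).2.2 (hKe hy.2.1) _ _
  unfold pathForm
  refine (((hH.const_smul (1 / 2 : ℝ)).add ?_).add ?_).sub ?_ <;>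
  · refine Continuous.continuousOn ?_
    have h1 := continuous_hermForm (b e)
    have h2 := continuous_symmForm (T e)
    fun_prop

/-- Since `Ψ σ = σ F` there, the form without barrier is `σ` times the hypothesis plus `(1-σ) ω₀`.
This is why `β` and `T` are scaled by `σ` along the path. -/
lemma pathForm_boundary (hb : IsConstKahlerMetric b) {ε : ℝ} {F : ℂ → V → ℝ}
    (hsol : ∀ σ ∈ Icc (0 : ℝ) 1, IsSolution R b ε (fun τ x => σ * F τ x) (Ψ σ))
    (hC4 : ∀ σ ∈ Icc (0 : ℝ) 1, IsC4UpToBoundary n R (Ψ σ))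
    (hF : ∀ τ ∈ frontier R, ∀ e ∈ atlas (Fin n → ℂ) V, ∀ z ∈ e.target, ∀ ξ ≠ 0,
      0 < 1 / 2 * realHess (fun z => F τ (e.symm z)) z ξ ξ + (1 - β) * hermForm (b e) ξ
        + symmForm (T e) ξ)
    {σ : ℝ} (hσ : σ ∈ Icc (0 : ℝ) 1) {τ : ℂ} (hτ : τ ∈ frontier R)
    {e : OpenPartialHomeomorph V (Fin n → ℂ)} (he : e ∈ atlas (Fin n → ℂ) V)
    {z : Fin n → ℂ} (hz : z ∈ e.target) {ξ : Fin n → ℂ} (hξ : ξ ≠ 0) :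
    0 < pathForm b T Ψ β (0, σ, τ) e z ξ := by
  have hτ' : τ ∈ closure R := frontier_subset_closure hτ
  have e1 : (fun z => F τ (e.symm z)) = fun z => Ψ 1 τ (e.symm z) := by
    funext z
    rw [(hsol 1 (by simp)).boundary τ hτ, one_mul]
  -- The fibre regularity of `F` is read off from `Ψ 1`, which agrees with it over the boundary.
  have c1 : ContDiffAt ℝ 2 (fun z => F τ (e.symm z)) z := by
    rw [e1]; exact (hC4 1 (by simp)).contDiffAt_slice he hτ' hz
  have c2 := (hC4 σ hσ).contDiffAt_slice he hτ' hz
  have e2 : realHess (fun z => Ψ σ τ (e.symm z)) z ξ ξ =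
      σ * realHess (fun z => F τ (e.symm z)) z ξ ξ := by
    refine (hasSecondDiff_line c2 ξ).unique (((hasSecondDiff_line c1 ξ).const_mul σ).congr
      (Eventually.of_forall fun r => ?_))
    exact ((hsol σ hσ).boundary τ hτ _).symm
  have h1 := hF τ hτ e he z hz ξ hξ
  have h2 := hermForm_pos (hb.posDef e he) hξ
  rw [pathForm, zero_mul, sub_zero]
  dsimp only
  rw [e2]
  rcases eq_or_lt_of_le hσ.1 with h0 | h0
  · rw [← h0]; linarith
  · have h3 := mul_pos h0 h1
    have h4 := mul_nonneg (sub_nonneg.2 hσ.2) h2.le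
    linarith

lemma pathForm_zero_path (hb : IsConstKahlerMetric b)
    (hconst : ∀ τ ∈ closure R, ∀ x y, Ψ 0 τ x ≤ Ψ 0 τ y) (κ : ℝ) {τ : ℂ} (hτ : τ ∈ closure R)
    (hκ : κ * (1 + ‖τ‖ ^ 2) < 1)
    {e : OpenPartialHomeomorph V (Fin n → ℂ)} (he : e ∈ atlas (Fin n → ℂ) V)
    (z : Fin n → ℂ) {ξ : Fin n → ℂ} (hξ : ξ ≠ 0) :
    0 < pathForm b T Ψ β (κ, 0, τ) e z ξ := by
  have e1 : (fun z => Ψ 0 τ (e.symm z)) = fun _ => Ψ 0 τ (e.symm 0) :=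
    funext fun z => le_antisymm (hconst τ hτ _ _) (hconst τ hτ _ _)
  have h2 := hermForm_pos (hb.posDef e he) hξ
  rw [pathForm]
  dsimp only
  rw [e1]
  have e3 : realHess (fun _ : Fin n → ℂ => Ψ 0 τ (e.symm 0)) z ξ ξ = 0 := by
    have : fderiv ℝ (fun _ : Fin n → ℂ => Ψ 0 τ (e.symm 0)) = fun _ => 0 := by
      funext w; simp
    rw [realHess, this]
    simp
  rw [e3]
  nlinarith

/-- Along the continuity path, the convexity of the boundary values is inherited by the
solutions. -/
theorem convexity_of_boundary [CompactSpace V] [HasGroupoid V (affineGroupoid n)]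
    (hR : IsSmoothBoundedDomain R) (hb : IsConstKahlerMetric b) (hT : IsConstSection T) {ε : ℝ}
    (hε : 0 < ε) (hβ : 0 ≤ β) {F : ℂ → V → ℝ}
    (hsol : ∀ σ ∈ Icc (0 : ℝ) 1, IsSolution R b ε (fun τ x => σ * F τ x) (Ψ σ))
    (hC4 : ∀ σ ∈ Icc (0 : ℝ) 1, IsC4UpToBoundary n R (Ψ σ)) (hcur : IsC2ContinuousCurve n R Ψ)
    (hF : ∀ τ ∈ frontier R, ∀ e ∈ atlas (Fin n → ℂ) V, ∀ z ∈ e.target, ∀ ξ ≠ 0,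
      0 < 1 / 2 * realHess (fun z => F τ (e.symm z)) z ξ ξ + (1 - β) * hermForm (b e) ξ
        + symmForm (T e) ξ)
    {τ : ℂ} (hτ : τ ∈ closure R) {e : OpenPartialHomeomorph V (Fin n → ℂ)}
    (he : e ∈ atlas (Fin n → ℂ) V) {z : Fin n → ℂ} (hz : z ∈ e.target) {ξ : Fin n → ℂ}
    (hξ : ξ ≠ 0) :
    0 < 1 / 2 * realHess (fun z => Ψ 1 τ (e.symm z)) z ξ ξ + (1 - β) * hermForm (b e) ξ
        + symmForm (T e) ξ := by
  have hcpt : IsCompact (closure R) := hR.isBounded.isCompact_closure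
  have hbad : ∀ C : Set (ℝ × ℝ × ℂ), IsCompact C → C ⊆ univ ×ˢ Icc (0 : ℝ) 1 ×ˢ closure R →
      IsCompact {y ∈ C | ∃ e ∈ atlas (Fin n → ℂ) V, ∃ z ∈ e.target, ∃ ξ ≠ 0,
        pathForm b T Ψ β y e z ξ ≤ 0} := fun C hC hCs =>
    isCompact_setOf_not_pos hC (pathForm b T Ψ β)
      (fun e he K hK hKe => continuousOn_pathForm hR.uniqueDiffOn_closure hC4 hcur hCs he hK hKe)
      (fun y hy e he e' he' x hx hx' ξ hξ => exists_pathForm_transition hb hT hC4 (hCs hy).2.1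
        (hCs hy).2.2 he he' hx hx' hξ)
      (fun y e z ξ r => pathForm_smul y e z ξ r)
  -- the choice of `κ`
  obtain ⟨K, hK⟩ := (hcpt.image (continuous_norm.pow 2)).bddAbove
  have hK' : ∀ τ ∈ closure R, ‖τ‖ ^ 2 ≤ K := fun τ hτ => hK ⟨τ, hτ, rfl⟩
  have hK0 : 0 ≤ K := (sq_nonneg _).trans (hK' τ hτ)
  obtain ⟨κ, hκ0, hκ1, hκK, hκ⟩ : ∃ κ : ℝ, 0 < κ ∧ κ ≤ 1 ∧ κ * (1 + K) < 1 ∧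
      ∀ σ ∈ Icc (0 : ℝ) 1, ∀ τ ∈ frontier R, ∀ e ∈ atlas (Fin n → ℂ) V, ∀ z ∈ e.target,
        ∀ ξ ≠ 0, 0 < pathForm b T Ψ β (κ, σ, τ) e z ξ := by
    have h1 := hbad (Icc (0 : ℝ) 1 ×ˢ Icc (0 : ℝ) 1 ×ˢ frontier R)
      (isCompact_Icc.prod (isCompact_Icc.prod
        (hcpt.of_isClosed_subset isClosed_frontier frontier_subset_closure)))
      (prod_mono (subset_univ _) (prod_mono subset_rfl frontier_subset_closure))
    -- The values of `κ` that are bad somewhere over the boundary form a compact set missing `0`, so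
    -- every small positive `κ` is admissible. The further bound `κ (1 + K) < 1` secures positivity
    -- at `σ = 0`.
    have h2 := (h1.image continuous_fst).isClosed.isOpen_compl
    have h3 : (0 : ℝ) ∈ (Prod.fst '' {y ∈ Icc (0 : ℝ) 1 ×ˢ Icc (0 : ℝ) 1 ×ˢ frontier R |
        ∃ e ∈ atlas (Fin n → ℂ) V, ∃ z ∈ e.target, ∃ ξ ≠ 0,
          pathForm b T Ψ β y e z ξ ≤ 0})ᶜ := by
      rintro ⟨⟨κ, σ, τ⟩, ⟨⟨-, hσ, hτ⟩, e, he, z, hz, ξ, hξ, hle⟩, rfl⟩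
      exact absurd hle (not_le.2 (pathForm_boundary hb hsol hC4 hF hσ hτ he hz hξ))
    have h4 : ∀ᶠ κ in 𝓝[>] (0 : ℝ), κ ∈ (Prod.fst '' {y ∈ Icc (0 : ℝ) 1 ×ˢ Icc (0 : ℝ) 1 ×ˢ
        frontier R | ∃ e ∈ atlas (Fin n → ℂ) V, ∃ z ∈ e.target, ∃ ξ ≠ 0,
          pathForm b T Ψ β y e z ξ ≤ 0})ᶜ :=
      (h2.mem_nhds h3 : _ ∈ 𝓝 _) |> fun h => mem_nhdsWithin_of_mem_nhds h
    have h5 : ∀ᶠ κ in 𝓝[>] (0 : ℝ), κ < min 1 (1 / (1 + K)) :=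
      mem_nhdsWithin_of_mem_nhds (Iio_mem_nhds (by positivity))
    obtain ⟨κ, hκ4, hκ5, hκ6⟩ := (h4.and (h5.and self_mem_nhdsWithin)).exists
    have hκ6 : 0 < κ := hκ6
    have hκ1 : κ ≤ 1 := (hκ5.trans_le (min_le_left _ _)).le
    refine ⟨κ, hκ6, hκ1, ?_, ?_⟩
    · have := hκ5.trans_le (min_le_right _ _)
      rwa [lt_div_iff₀ (by positivity)] at this
    · intro σ hσ τ hτ e he z hz ξ hξ
      by_contra! hle
      exact hκ4 ⟨(κ, σ, τ), ⟨⟨⟨hκ6.le, hκ1⟩, hσ, hτ⟩, e, he, z, hz, ξ, hξ, hle⟩, rfl⟩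
  -- the set of parameters `σ` for which convexity fails
  have hB := (hbad ({κ} ×ˢ Icc (0 : ℝ) 1 ×ˢ closure R)
    (isCompact_singleton.prod (isCompact_Icc.prod hcpt))
    (prod_mono (subset_univ _) subset_rfl)).image (continuous_fst.comp continuous_snd)
  set B : Set ℝ := (Prod.fst ∘ Prod.snd) '' {y ∈ ({κ} : Set ℝ) ×ˢ Icc (0 : ℝ) 1 ×ˢ closure R |
    ∃ e ∈ atlas (Fin n → ℂ) V, ∃ z ∈ e.target, ∃ ξ ≠ 0, pathForm b T Ψ β y e z ξ ≤ 0} with hBdef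
  have hmem : ∀ σ ∈ Icc (0 : ℝ) 1, σ ∉ B → ∀ τ ∈ closure R, ∀ e ∈ atlas (Fin n → ℂ) V,
      ∀ z ∈ e.target, ∀ ξ ≠ 0, 0 < pathForm b T Ψ β (κ, σ, τ) e z ξ := by
    intro σ hσ hσB τ hτ e he z hz ξ hξ
    by_contra! hle
    exact hσB ⟨(κ, σ, τ), ⟨⟨rfl, hσ, hτ⟩, e, he, z, hz, ξ, hξ, hle⟩, rfl⟩
  have hBempty : B = ∅ := by
    by_contra hne
    -- At the least bad parameter the form has a nonpositive value on a nonzero vector. The choice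
    -- of `κ` excludes `s = 0` and boundary points.
    obtain ⟨s, hsB, hsmin⟩ := hB.exists_isLeast (nonempty_iff_ne_empty.2 hne)
    obtain ⟨⟨κ', s', τ₀⟩, ⟨⟨hκ', hs, hτ₀⟩, e₀, he₀, z₀, hz₀, ξ₀, hξ₀, hle⟩, hs'⟩ := hsB
    obtain rfl : κ' = κ := hκ'
    obtain rfl : s' = s := hs'
    have hs : s' ∈ Icc (0 : ℝ) 1 := hs
    have hs0 : 0 < s' := by
      refine lt_of_le_of_ne hs.1 fun h0 => ?_
      rw [← h0] at hle
      refine absurd hle (not_le.2 (pathForm_zero_path hb ?_ κ' hτ₀ ?_ he₀ z₀ hξ₀))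
      · exact (hsol 0 (by simp)).le_of_boundary_zero hR.isOpen hR.isBounded hb hε (by simp)
      · refine lt_of_le_of_lt (mul_le_mul_of_nonneg_left ?_ hκ0.le) hκK
        have := hK' _ hτ₀
        linarith
    have hτ₀R : τ₀ ∈ R := by
      by_contra hnot
      refine absurd hle (not_le.2 (hκ s' hs τ₀ ?_ e₀ he₀ z₀ hz₀ ξ₀ hξ₀))
      rw [hR.isOpen.frontier_eq]; exact ⟨hτ₀, hnot⟩
    -- The least bad parameter is a limit of good ones from below, so the form is still nonnegative
    -- there.
    have hnonneg : ∀ τ ∈ closure R, ∀ z ∈ e₀.target, ∀ ξ,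
        0 ≤ pathForm b T Ψ β (κ', s', τ) e₀ z ξ := by
      intro τ hτ z hz ξ
      by_cases hξ : ξ = 0
      · rw [hξ, pathForm_zero]
      have hc := continuousOn_pathForm (b := b) (T := T) (β := β) hR.uniqueDiffOn_closure hC4 hcur
        (subset_refl (univ ×ˢ Icc (0 : ℝ) 1 ×ˢ closure R)) he₀ isCompact_singleton
        (singleton_subset_iff.2 hz)
      have hc' : ContinuousOn (fun σ : ℝ => pathForm b T Ψ β (κ', σ, τ) e₀ z ξ) (Icc 0 1) :=
        hc.comp (f := fun σ : ℝ => ((κ', σ, τ), z, ξ)) (by fun_prop)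
          fun σ hσ => ⟨⟨mem_univ _, hσ, hτ⟩, rfl, mem_univ _⟩
      have hlim : Tendsto (fun σ : ℝ => pathForm b T Ψ β (κ', σ, τ) e₀ z ξ) (𝓝[Ico 0 s'] s')
          (𝓝 (pathForm b T Ψ β (κ', s', τ) e₀ z ξ)) :=
        (hc' s' hs).mono_left (nhdsWithin_mono _ fun σ hσ => ⟨hσ.1, hσ.2.le.trans hs.2⟩)
      have : (𝓝[Ico 0 s'] s').NeBot := by
        rw [← mem_closure_iff_nhdsWithin_neBot, closure_Ico hs0.ne]
        exact ⟨hs0.le, le_rfl⟩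
      refine ge_of_tendsto hlim ?_
      filter_upwards [self_mem_nhdsWithin] with σ hσ
      refine (hmem σ ⟨hσ.1, hσ.2.le.trans hs.2⟩ (fun hσB => ?_) τ hτ e₀ he₀ z hz ξ hξ).le
      exact absurd (hsmin hσB) (not_le.2 hσ.2)
    have hopen : IsOpen (R ×ˢ e₀.target) := hR.isOpen.prod e₀.open_target
    have hmem₀ : (τ₀, z₀) ∈ R ×ˢ e₀.target := ⟨hτ₀R, hz₀⟩
    have hCd : ∀ q ∈ R ×ˢ e₀.target, ContDiffAt ℝ 4 (inChart e₀ (Ψ s')) q := fun q hq =>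
      ((hC4 s' hs e₀ he₀).mono (prod_mono subset_closure subset_rfl)).contDiffAt
        (hopen.mem_nhds hq)
    have hform : ∀ q ∈ R ×ˢ e₀.target, ∀ ξ,
        convexityForm (inChart e₀ (Ψ s')) (b e₀) ((s' : ℂ) • T e₀) (s' * β) κ' q ξ =
          pathForm b T Ψ β (κ', s', q.1) e₀ q.2 ξ := by
      intro q hq ξ
      have h1 := realHess_slice_eq ((hCd q hq).of_le (by norm_num : (2 : ℕ∞ω) ≤ 4)) ξ
      have h2 : symmForm ((s' : ℂ) • T e₀) ξ = s' * symmForm (T e₀) ξ := by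
        simp [symmForm, smul_mulVec]
      rw [convexityForm, pathForm, ← h1, h2]
      rfl
    have hfinal := convexityForm_pos_of_nonneg (T := (s' : ℂ) • T e₀) (hCd _ hmem₀)
      (hb.posDef e₀ he₀) (mul_nonneg hs.1 hβ) hκ0 hε (by
        filter_upwards [hopen.mem_nhds hmem₀] with q hq
        have h1 := (hsol s' hs).posDef e₀ he₀ q.1 hq.1 _ (e₀.map_target hq.2)
        have h2 := (hsol s' hs).equation e₀ he₀ q.1 hq.1 _ (e₀.map_target hq.2)
        rw [productForm_eq_coordForm, e₀.right_inv hq.2] at h1 h2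
        exact ⟨h1, h2⟩) (by
        filter_upwards [hopen.mem_nhds hmem₀] with q hq ξ
        rw [hform q hq]
        exact hnonneg _ (subset_closure hq.1) _ hq.2 ξ) hξ₀
    rw [hform _ hmem₀] at hfinal
    exact absurd hle (not_le.2 hfinal)
  -- At `σ = 1` the form with the barrier subtracted is positive, hence so is the form without it.
  have h1 := hmem 1 (by simp) (by rw [hBempty]; simp) τ hτ e he z hz ξ hξ
  rw [pathForm] at h1
  dsimp only at h1
  have h2 : 0 ≤ κ * ((1 + ‖τ‖ ^ 2) * hermForm (b e) ξ) :=
    mul_nonneg hκ0.le (mul_nonneg (by positivity) (hermForm_nonneg (hb.posDef e he) ξ))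
  linarith

end ContinuityPath

/-! ### Strict convexity as positivity of the corrected real Hessian. -/

section StrictConvexity

variable {n : ℕ}

/-- Averaging over `ξ` and `iξ` cancels the symmetric part. -/
lemma posDef_of_hermForm_add_symmForm_pos {A B : Matrix (Fin n) (Fin n) ℂ} (hA : A.IsHermitian)
    (h : ∀ ξ : Fin n → ℂ, ξ ≠ 0 → 0 < hermForm A ξ + symmForm B ξ) : A.PosDef := by
  refine posDef_of_hermForm_pos hA fun ξ hξ => ?_
  have h1 := h ξ hξ
  have h2 := h (Complex.I • ξ) (smul_ne_zero Complex.I_ne_zero hξ)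
  rw [hermForm_I_smul, symmForm_I_smul] at h2
  linarith

variable {V : Type*} [TopologicalSpace V]

/-- Strict `(S, ω₀)`-convexity is positivity of the real Hessian of `φ`, corrected by `ω₀` and
by the real part of `S`. -/
lemma isStrictlyConvexOnChart_iff {e : OpenPartialHomeomorph V (Fin n → ℂ)}
    {b S : Matrix (Fin n) (Fin n) ℂ} {φ : V → ℝ} (hb : b.IsHermitian) (hS : S.IsSymm)
    (hφ : ContDiffOn ℝ 2 (fun z => φ (e.symm z)) e.target) :
    IsStrictlyConvexOnChart e b S φ ↔ ∀ z ∈ e.target, ∀ ξ ≠ 0,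
      0 < 1 / 2 * realHess (fun z => φ (e.symm z)) z ξ ξ + hermForm b ξ + symmForm S ξ := by
  have hd : ∀ x ∈ e.source, ContDiffAt ℝ 2 (fun z => φ (e.symm z)) (e x) := fun x hx =>
    hφ.contDiffAt (e.open_target.mem_nhds (e.map_source hx))
  have hform : ∀ x ξ, hermForm (b + hessMixed e φ x) ξ + symmForm (hessPure e φ x + S) ξ =
      1 / 2 * realHess (fun z => φ (e.symm z)) (e x) ξ ξ + hermForm b ξ + symmForm S ξ := by
    intro x ξ
    rw [hermForm_add, symmForm_add, ← hermForm_hessMixed_add_symmForm_hessPure]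
    ring
  constructor
  · intro h z hz ξ hξ
    obtain ⟨h1, h2⟩ := h (e.symm z) (e.map_target hz)
    have h3 := hform (e.symm z) ξ
    have h4 := abs_symmForm_lt_of_maxEigenvalueLT h1
      ((isSymm_hessPure (hd _ (e.map_target hz))).add hS) h2 hξ
    rw [e.right_inv hz] at h3
    rw [← h3]
    have := neg_abs_le (symmForm (hessPure e φ (e.symm z) + S) ξ)
    linarith
  · intro h x hx
    have h1 : ∀ ξ : Fin n → ℂ, ξ ≠ 0 →
        0 < hermForm (b + hessMixed e φ x) ξ + symmForm (hessPure e φ x + S) ξ := by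
      intro ξ hξ
      rw [hform]
      exact h _ (e.map_source hx) ξ hξ
    have h2 := posDef_of_hermForm_add_symmForm_pos (hb.add (isHermitian_hessMixed (hd x hx))) h1
    exact ⟨h2, maxEigenvalueLT_of_forall_pos h2 ((isSymm_hessPure (hd x hx)).add hS) h1⟩

end StrictConvexity

end

/-! ### Assembly of the two claims. -/

theorem mainTheorem4 {n : ℕ} {V : Type*} [TopologicalSpace V] [T2Space V] [CompactSpace V]
    [ChartedSpace (Fin n → ℂ) V] [HasGroupoid V (affineGroupoid n)]
    (R : Set ℂ) (hR : IsSmoothBoundedDomain R)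
    (b : OpenPartialHomeomorph V (Fin n → ℂ) → Matrix (Fin n) (Fin n) ℂ)
    (hb : IsConstKahlerMetric b)
    (S : OpenPartialHomeomorph V (Fin n → ℂ) → Matrix (Fin n) (Fin n) ℂ)
    (hS : IsConstSection S)
    (δ ε : ℝ) (hδ : 0 < δ) (hε : 0 < ε)
    (F : ℂ → V → ℝ) (hF : IsSmoothOnBoundary n R F)
    (hpath : ContinuityPathAssumption R b ε F)
    (Φ : ℂ → V → ℝ) (hΦ : IsSolution R b ε F Φ) :
    ((∀ τ ∈ frontier R, IsConvexOfDegreeGT b S δ (F τ)) →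
      ∀ τ ∈ closure R, IsConvexOfDegreeGT b S δ (Φ τ) ∧ MetricGT b δ (Φ τ)) ∧
    ((∀ τ ∈ frontier R, IsConvexOfGlobalDegreeGT b S δ (F τ)) →
      ∀ τ ∈ closure R, IsConvexOfGlobalDegreeGT b S δ (Φ τ)) := by
  obtain ⟨Ψ, hΨ, hcur⟩ := hpath
  have hsol := fun σ hσ => (hΨ σ hσ).1
  have hC4 := fun σ hσ => (hΨ σ hσ).2
  have hΨ1 : IsSolution R b ε F (Ψ 1) := by
    simpa only [one_mul] using hsol 1 (by simp)
  have heq : ∀ τ ∈ closure R, Φ τ = Ψ 1 τ := fun τ hτ =>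
    hΦ.eq_of_boundary_eq hR.isOpen hR.isBounded hb hε hΨ1 hτ
  have hC2 : ∀ τ ∈ closure R, IsC2 n (Ψ 1 τ) := fun τ hτ e he =>
    (contDiffOn_slice (hC4 1 (by simp) e he) hτ).of_le (by norm_num)
  constructor
  · intro hconv τ hτ
    have hpos : ∀ e ∈ atlas (Fin n → ℂ) V, ∀ z ∈ e.target, ∀ ξ ≠ 0,
        0 < 1 / 2 * realHess (fun z => Ψ 1 τ (e.symm z)) z ξ ξ + (1 - δ) * hermForm (b e) ξ
          + symmForm (S e) ξ := by
      intro e he z hz ξ hξ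
      refine convexity_of_boundary hR hb hS hε hδ.le hsol hC4 hcur ?_ hτ he hz hξ
      intro τ hτ e he z hz ξ hξ
      obtain ⟨hF2, hFc⟩ := hconv τ hτ
      -- The worst `Θ` for the given `ξ` replaces the whole family by the factor `1 - δ`. It depends
      -- on `ξ` and lives only on the chart domain, so this step is available only for the chartwise
      -- notion of degree.
      obtain ⟨Θ, hΘ1, hΘ2, hΘ3⟩ := exists_symm_attaining (hb.posDef e he) (δ := δ) hξ
      have h1 := (isStrictlyConvexOnChart_iff (hb.posDef e he).isHermitian
        ((hS.symm e he).add hΘ1) (hF2 e he)).1 (hFc e he Θ hΘ1 hΘ2) z hz ξ hξ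
      rw [symmForm_add, hΘ3] at h1
      linarith
    rw [heq τ hτ]
    refine ⟨⟨hC2 τ hτ, fun e he Θ hΘ1 hΘ2 => ?_⟩, fun e he x hx => ?_⟩
    · rw [isStrictlyConvexOnChart_iff (hb.posDef e he).isHermitian
        ((hS.symm e he).add hΘ1) (hC2 τ hτ e he)]
      intro z hz ξ hξ
      have h1 := hpos e he z hz ξ hξ
      have h2 := (abs_le.1 (abs_symmForm_le_of_maxEigenvalueLE (hb.posDef e he) hΘ1 hδ.le hΘ2 ξ)).1
      rw [symmForm_add]
      linarith
    · have hx' := e.map_source hx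
      have hd := (hC2 τ hτ e he).contDiffAt (e.open_target.mem_nhds hx')
      -- The complex Hessian minus `δ ω₀` is the Hermitian part of the positive form with factor `1
      -- - δ`.
      refine posDef_of_hermForm_add_symmForm_pos (B := hessPure e (Ψ 1 τ) x + S e)
        (((hb.posDef e he).isHermitian.add (isHermitian_hessMixed hd)).sub ?_) fun ξ hξ => ?_
      · rw [IsHermitian, conjTranspose_smul, (hb.posDef e he).isHermitian.eq]
        simp
      · have h1 := hpos e he _ hx' ξ hξ
        rw [← hermForm_hessMixed_add_symmForm_hessPure] at h1
        rw [hermForm_sub, hermForm_add, symmForm_add, hermForm_real_smul_mat]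
        linarith
  · intro hconv τ hτ
    rw [heq τ hτ]
    refine ⟨hC2 τ hτ, fun Θ hΘ1 hΘ2 e he => ?_⟩
    have hT : IsConstSection (S + Θ) := by
      refine ⟨fun e he => (hS.symm e he).add (hΘ1.symm e he), fun e he e' he' x hx => ?_⟩
      rw [Pi.add_apply, Pi.add_apply, hS.compat e he e' he' x hx, hΘ1.compat e he e' he' x hx,
        Matrix.mul_add, Matrix.add_mul]
    rw [isStrictlyConvexOnChart_iff (hb.posDef e he).isHermitian (hT.symm e he) (hC2 τ hτ e he)]
    intro z hz ξ hξ
    -- Each global `Θ` is propagated separately as part of the constant section `S + Θ`, with `β =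
    -- 0`.
    have h1 := convexity_of_boundary hR hb hT hε le_rfl hsol hC4 hcur
      (fun τ hτ e he z hz ξ hξ => by
        obtain ⟨hF2, hFc⟩ := hconv τ hτ
        have h2 := (isStrictlyConvexOnChart_iff (hb.posDef e he).isHermitian (hT.symm e he)
          (hF2 e he)).1 (hFc Θ hΘ1 hΘ2 e he) z hz ξ hξ
        linarith) hτ he hz hξ
    linarith
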